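/- **Setting.** For each sample size $n$ let $p=p_n\ge 1$ and observe $x_{il}=\eta_l(\boldsymbol\alpha_i)+u_{il}$, $1\le i\le n$, $1\le l\le p$, where $\boldsymbol\alpha_i\in\mathbb R^r$ ($r\ge1$) are random latent variables, $\eta_l:\mathbb R^r\to\mathbb R$ are random latent functions, and all these objects may depend on $n$. Let $\mathscr F=\mathscr F_n$ be the $\sigma$-field generated by $(\boldsymbol\alpha_i)_{i\le n}$ and $(\eta_l)_{l\le p}$, and assume $\mathbb E[u_{il}|\mathscr F]=0$. Let $\mathcal R^\dagger\subseteq\{1,\dots,p\}$ with $p^\dagger=|\mathcal R^\dagger|\asymp p$. Write $\boldsymbol\eta^\dagger=(\eta_l)_{l\in\mathcal R^\dagger}$, $\mathbf{H}^\dagger(\boldsymbol\alpha)=\boldsymbol\eta^\dagger(\boldsymbol\alpha)$, $\mathbf{H}^\dagger_{\cdot i}=\boldsymbol\eta^\dagger(\boldsymbol\alpha_i)$, $\mathbf{X}^\dagger_{\cdot i}=(x_{il})_{l\in\mathcal R^\dagger}$, and let $\rho$ be the pseudo-max distance: for vectors $\mathbf{v}_1,\dots,\mathbf{v}_n\in\mathbb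 R^{p^\dagger}$, $\rho(\mathbf{v}_i,\mathbf{v}_j)=\max_{l\ne i,j}\frac1{p^\dagger}|(\mathbf{v}_i-\mathbf{v}_j)'\mathbf{v}_l|$. For random sequences, $X_n\lesssim_{\mathbb P}Y_n$ means $\lim_{\varepsilon\to\infty}\limsup_n\mathbb P(|X_n/Y_n|\ge\varepsilon)=0$, and $X_n\gtrsim_{\mathbb P}Y_n$ means $Y_n\lesssim_{\mathbb P}X_n$. **Regularity.** Let $\nu>0$ and let $\bar m\ge2$ be an integer. (a) For each $n$, $\boldsymbol\alpha_1,\dots,\boldsymbol\alpha_n$ are i.i.d. with compact convex support $\mathcal A$ (the same for all $n$) and a Lebesgue density on $\mathcal A$ that is bounded and bounded away from zero, uniformly in $n$. (b) Almost surely each $\eta_l$ is $\bar m$ times continuously differentiable on $\mathcal A$, with all partial derivatives of order at most $\bar m$ bounded on $\mathcal A$ by a universal constant (derivatives on the boundary are taken within $\mathcal A$). (c) The $u_{il}$ are independent over $i$ and $l$ conditional on $\mathscr F$, and $\sup_n\max_{i\le n,\,l\le p_n}\mathbb E[|u_{il}|^{2+\nu}|\mathscr F]<\infty$ almost surely. **Theorem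 (Pseudo-max distance).** Under these regularity conditions, suppose moreover that: (i) for every $\varepsilon>0$, $\displaystyle\lim_{\Delta\downarrow0}\limsup_{n\to\infty}\mathbb P\Big\{\max_{i\le n}\ \max_{j:\rho(\mathbf{H}^\dagger_{\cdot i},\mathbf{H}^\dagger_{\cdot j})<\Delta}\|\boldsymbol\alpha_i-\boldsymbol\alpha_j\|>\varepsilon\Big\}=0$; (ii) for some $\underline c>0$, $\displaystyle\lim_{n\to\infty}\mathbb P\Big\{\min_{i\le n}s_{\min}\Big(\tfrac1{p^\dagger}\nabla\boldsymbol\eta^\dagger(\boldsymbol\alpha_i)'\,\nabla\boldsymbol\eta^\dagger(\boldsymbol\alpha_i)\Big)\ge\underline c\Big\}=1$, where $\nabla\boldsymbol\eta^\dagger$ is the $p^\dagger\times r$ Jacobian matrix and $s_{\min}$ the smallest singular value; (iii) (non-collapsing) for some $\underline c'>0$, with probability tending to one, for every $i\le n$ the column space of $\nabla\boldsymbol\eta^\dagger(\boldsymbol\alpha_i)$ is $r$-dimensional and has an orthonormal basis $\mathbf{e}_1,\dots,\mathbf{e}_r$ such that $\displaystyle\sup_{\boldsymbol\alpha\in\mathcal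 A}\tfrac1{p^\dagger}\|\mathscr P_{\mathbf{e}_\ell}[\mathbf{H}^\dagger(\boldsymbol\alpha)]\|^2\ge\underline c'$ for all $\ell\le r$, where $\mathscr P_{\mathbf{e}}$ is the orthogonal projection onto the line spanned by $\mathbf{e}$; (iv) $\displaystyle\frac{n^{4/\nu}(\log n)^{(\nu-2)/\nu}}{p}\lesssim1$. Then, with $a_n=((\log n)/p)^{1/2}$, one has $a_n>0$ for all large $n$, $a_n\to0$, and $$\max_{1\le i,j\le n}\big|\rho(\mathbf{X}^\dagger_{\cdot i},\mathbf{X}^\dagger_{\cdot j})-\rho(\mathbf{H}^\dagger_{\cdot i},\mathbf{H}^\dagger_{\cdot j})\big|\lesssim_{\mathbb P}a_n,$$ $$\max_{\boldsymbol\alpha_i\neq\boldsymbol\alpha_j}\frac{\rho(\mathbf{H}^\dagger_{\cdot i},\mathbf{H}^\dagger_{\cdot j})}{\|\boldsymbol\alpha_i-\boldsymbol\alpha_j\|}\lesssim_{\mathbb P}1,\qquad \min_{\boldsymbol\alpha_i\neq\boldsymbol\alpha_j}\frac{\rho(\mathbf{H}^\dagger_{\cdot i},\mathbf{H}^\dagger_{\cdot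 j})}{\|\boldsymbol\alpha_i-\boldsymbol\alpha_j\|}\gtrsim_{\mathbb P}1,$$ that is, the indirect matching assumption holds with $a_n=((\log n)/p)^{1/2}$, $\rho_0=0$ and $\underline\varsigma=\bar\varsigma=1$. -/

import Mathlib

open MeasureTheory ProbabilityTheory Filter Topology
open scoped ENNReal

noncomputable section

/-- The pseudo-max distance between the `i`-th and the `j`-th member of a family of vectors
`v 1, …, v n` indexed by `ι`:  `max_{l ≠ i, j} |(v i - v j)' v l| / |ι|`. -/
def pseudoMaxDist (n : ℕ) (ι : Type) [Fintype ι] (v : Fin n → EuclideanSpace ℝ ι)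
    (i j : Fin n) : ℝ :=
  ⨆ l : {l : Fin n // l ≠ i ∧ l ≠ j}, |inner ℝ (v i - v j) (v l)| / (Fintype.card ι : ℝ)

/-- The smallest singular value of an `r × r` matrix (singular values are numbered from `0`
in descending order). -/
def sMin {r : ℕ} (G : Matrix (Fin r) (Fin r) ℝ) : ℝ :=
  (Matrix.toEuclideanLin G).singularValues (r - 1)

section Stochastic

variable {Ω : Type*} [MeasurableSpace Ω]

/-- `X n ≲_P Y n`:  `limsup_{ε → ∞} limsup_n P(|X n / Y n| ≥ ε) = 0`. The event is written
`ε |Y n| ≤ |X n|`, so that `X n / Y n` counts as infinite where `Y n` vanishes. -/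
def StochLE (μ : Measure Ω) (X Y : ℕ → Ω → ℝ) : Prop :=
  limsup (fun ε : ℝ => limsup (fun n : ℕ => μ {ω | ε * |Y n ω| ≤ |X n ω|}) atTop) atTop = 0

/-- The events `E n` have probability tending to one (the probability of the complement
tends to zero). -/
def ProbTendsToOne (μ : Measure Ω) (E : ℕ → Set Ω) : Prop :=
  Tendsto (fun n => μ (E n)ᶜ) atTop (𝓝 0)

/-- Conditional independence, given the `σ`-field `m`, of a family of real random variables:
`P(⋂ i ∈ S, {f i ∈ B i} | m) = ∏ i ∈ S, P(f i ∈ B i | m)` a.s. for all finite `S` and Borel `B`.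
(Mathlib's `iCondIndepFun` is the same notion, on standard Borel sample spaces only.) -/
def CondIndepFamily {ι : Type*} (μ : Measure Ω) (m : MeasurableSpace Ω) (f : ι → Ω → ℝ) : Prop :=
  ∀ (S : Finset ι) (B : ι → Set ℝ), (∀ i ∈ S, MeasurableSet (B i)) →
    (μ⟦⋂ i ∈ S, f i ⁻¹' B i | m⟧) =ᵐ[μ] ∏ i ∈ S, (μ⟦f i ⁻¹' B i | m⟧)

end Stochastic

/-- The random ingredients, for every sample size `n`, of a nonlinear factor model with `r` latent
variables: the number `p n` of features, the set `R n` of the features (rows) used for matching,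
the latent variables `α n i`, the (random) latent functions `η n l ω : ℝ^r → ℝ`, and the errors
`u n i l`. -/
structure FactorModel (Ω : Type*) [MeasurableSpace Ω] (r : ℕ) where
  p : ℕ → ℕ
  p_pos : ∀ n, 0 < p n
  R : ∀ n, Finset (Fin (p n))
  α : ∀ n, Fin n → Ω → EuclideanSpace ℝ (Fin r)
  η : ∀ n, Fin (p n) → Ω → EuclideanSpace ℝ (Fin r) → ℝ
  u : ∀ n, Fin n → Fin (p n) → Ω → ℝ
  measurable_α : ∀ n i, Measurable (α n i)
  measurable_η : ∀ n l x, Measurable (fun ω => η n l ω x)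
  measurable_u : ∀ n i l, Measurable (u n i l)

namespace FactorModel

variable {Ω : Type*} [mΩ : MeasurableSpace Ω] {r : ℕ} (M : FactorModel Ω r)

/-- The `σ`-field generated by the latent variables and the latent functions. -/
abbrev F (n : ℕ) : MeasurableSpace Ω :=
  (⨆ i, MeasurableSpace.comap (M.α n i) inferInstance) ⊔
    ⨆ l, ⨆ x, MeasurableSpace.comap (fun ω => M.η n l ω x) inferInstance

theorem F_le (n : ℕ) : M.F n ≤ mΩ :=
  sup_le (iSup_le fun i => (M.measurable_α n i).comap_le)
    (iSup_le fun l => iSup_le fun x => (M.measurable_η n l x).comap_le)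

/-- The number of features used for matching. -/
def pR (n : ℕ) : ℝ := (M.R n).card

/-- The vector `(η_l(x))` of the latent functions with index in `R n`, at the point `x`. -/
def etaR (n : ℕ) (ω : Ω) (x : EuclideanSpace ℝ (Fin r)) : EuclideanSpace ℝ (M.R n) :=
  WithLp.toLp 2 fun l => M.η n l ω x

/-- The `i`-th column of the noise-free matrix, rows in `R n`. -/
def H (n : ℕ) (ω : Ω) (i : Fin n) : EuclideanSpace ℝ (M.R n) :=
  M.etaR n ω (M.α n i ω)

/-- The `i`-th column of the data matrix, rows in `R n`: `x_{il} = η_l(α_i) + u_{il}`. -/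
def X (n : ℕ) (ω : Ω) (i : Fin n) : EuclideanSpace ℝ (M.R n) :=
  WithLp.toLp 2 fun l => M.η n l ω (M.α n i ω) + M.u n i l ω

/-- The Jacobian matrix at `x` of the latent functions with index in `R n`; derivatives are
taken within the support `A`. -/
def jacobian (A : Set (EuclideanSpace ℝ (Fin r))) (n : ℕ) (ω : Ω)
    (x : EuclideanSpace ℝ (Fin r)) : Matrix (M.R n) (Fin r) ℝ :=
  Matrix.of fun l j => fderivWithin ℝ (M.η n l ω) A x (EuclideanSpace.single j 1)

/-- The linear subspace spanned by the columns of the Jacobian matrix at `x`. -/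
def tangentSpace (A : Set (EuclideanSpace ℝ (Fin r))) (n : ℕ) (ω : Ω)
    (x : EuclideanSpace ℝ (Fin r)) : Submodule ℝ (EuclideanSpace ℝ (M.R n)) :=
  Submodule.span ℝ (Set.range fun j : Fin r => WithLp.toLp 2 fun l => M.jacobian A n ω x l j)

/-- The standing regularity conditions, with compact convex support `A`, smoothness `m` and
moment exponent `2 + ν`. -/
structure Regularity (μ : Measure Ω) (A : Set (EuclideanSpace ℝ (Fin r))) (m : ℕ) (ν : ℝ) :
    Prop where
  isCompact : IsCompact A
  convex : Convex ℝ A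
  /-- The latent variables of each sample are independent. -/
  indep : ∀ n, iIndepFun (M.α n) μ
  /-- They have a common law, with support `A` and a density there that is bounded and bounded
  away from zero. -/
  density : ∃ c C : ℝ, 0 < c ∧ ∀ n, ∃ f : EuclideanSpace ℝ (Fin r) → ℝ, Measurable f ∧
    (∀ x ∈ A, c ≤ f x ∧ f x ≤ C) ∧
    ∀ i, μ.map (M.α n i) = (volume.restrict A).withDensity fun x => ENNReal.ofReal (f x)
  two_le : 2 ≤ m
  /-- The latent functions are `m` times continuously differentiable on `A`, and their derivatives
  of order at most `m` are bounded by a universal constant. -/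
  smooth : ∃ C : ℝ, ∀ n, ∀ᵐ ω ∂μ, ∀ l, ContDiffOn ℝ m (M.η n l ω) A ∧
    ∀ k ≤ m, ∀ x ∈ A, ‖iteratedFDerivWithin ℝ k (M.η n l ω) A x‖ ≤ C
  /-- The errors are independent over `i` and `l` conditional on the `σ`-field `F`. -/
  condIndep : ∀ n, CondIndepFamily μ (M.F n) fun q : Fin n × Fin (M.p n) => M.u n q.1 q.2
  integrable_u : ∀ n i l, Integrable (M.u n i l) μ
  condMean : ∀ n i l, μ[M.u n i l | M.F n] =ᵐ[μ] 0
  ν_pos : 0 < ν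
  /-- The conditional moments of order `2 + ν` are almost surely bounded, over all `i`, `l`
  and all sample sizes. -/
  moment : ∀ᵐ ω ∂μ, (⨆ n, ⨆ i, ⨆ l,
    condLExp (M.F n) μ (fun ω' => ENNReal.ofReal (|M.u n i l ω'| ^ (2 + ν))) ω) < ∞

/-- Identification: the distance `ρ` of the noise-free structure reveals the differences of the
latent variables. -/
def Identified (μ : Measure Ω) (ρ : ∀ (n : ℕ) (ι : Type) [Fintype ι],
    (Fin n → EuclideanSpace ℝ ι) → Fin n → Fin n → ℝ) : Prop :=
  ∀ ε > (0 : ℝ), Tendsto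
    (fun Δ : ℝ => limsup (fun n => μ {ω | ∃ i j : Fin n,
      ρ n (M.R n) (M.H n ω) i j < Δ ∧ ε < ‖M.α n i ω - M.α n j ω‖}) atTop)
    (𝓝[>] 0) (𝓝 0)

/-- With probability tending to one, the smallest singular values of the scaled Gram matrices of
the Jacobian at the data points are bounded away from zero. -/
def JacobianNondegenerate (μ : Measure Ω) (A : Set (EuclideanSpace ℝ (Fin r))) : Prop :=
  ∃ c > (0 : ℝ), ProbTendsToOne μ fun n => {ω | ∀ i : Fin n,
    c ≤ sMin ((1 / M.pR n) •
      ((M.jacobian A n ω (M.α n i ω)).transpose * M.jacobian A n ω (M.α n i ω)))}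

/-- Non-collapsing: with probability tending to one, at every data point, the tangent space has an
orthonormal basis of `r` vectors such that the projection of the latent surface onto each of these
directions does not degenerate. -/
def NonCollapsing (μ : Measure Ω) (A : Set (EuclideanSpace ℝ (Fin r))) : Prop :=
  ∃ c > (0 : ℝ), ProbTendsToOne μ fun n => {ω | ∀ i : Fin n,
    ∃ b : OrthonormalBasis (Fin r) ℝ (M.tangentSpace A n ω (M.α n i ω)), ∀ k : Fin r,
      c ≤ ⨆ x : A, (1 / M.pR n) *
        ‖(Submodule.span ℝ {(b k : EuclideanSpace ℝ (M.R n))}).starProjection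
          (M.etaR n ω x)‖ ^ 2}

/-- The indirect matching conditions for the distance `ρ`, with denoising error `a n`, shift `ρ₀`,
lower exponent `s` and upper exponent `t`. -/
structure IndirectMatching (μ : Measure Ω) (ρ : ∀ (n : ℕ) (ι : Type) [Fintype ι],
    (Fin n → EuclideanSpace ℝ ι) → Fin n → Fin n → ℝ) (a : ℕ → ℝ) (ρ₀ s t : ℝ) : Prop where
  shift_nonneg : 0 ≤ ρ₀
  lower_pos : 0 < s
  upper_pos : 0 < t
  a_pos : ∀ᶠ n in atTop, 0 < a n
  a_tendsto : Tendsto a atTop (𝓝 0)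
  /-- `max_{i,j} |ρ(X_i, X_j) - ρ(H_i, H_j) - ρ₀| ≲_P a_n`. -/
  denoising : StochLE μ
    (fun n ω => ⨆ q : Fin n × Fin n,
      |ρ n (M.R n) (M.X n ω) q.1 q.2 - ρ n (M.R n) (M.H n ω) q.1 q.2 - ρ₀|)
    (fun n _ => a n)
  /-- `max_{α_i ≠ α_j} ρ(H_i, H_j) / ‖α_i - α_j‖ ^ t ≲_P 1`. -/
  upper : StochLE μ
    (fun n ω => ⨆ q : {q : Fin n × Fin n // M.α n q.1 ω ≠ M.α n q.2 ω},
      ρ n (M.R n) (M.H n ω) q.1.1 q.1.2 / ‖M.α n q.1.1 ω - M.α n q.1.2 ω‖ ^ t)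
    (fun _ _ => 1)
  /-- `1 ≲_P min_{α_i ≠ α_j} ρ(H_i, H_j) / ‖α_i - α_j‖ ^ s`. -/
  lower : StochLE μ
    (fun _ _ => 1)
    (fun n ω => ⨅ q : {q : Fin n × Fin n // M.α n q.1 ω ≠ M.α n q.2 ω},
      ρ n (M.R n) (M.H n ω) q.1.1 q.1.2 / ‖M.α n q.1.1 ω - M.α n q.1.2 ω‖ ^ s)

end FactorModel

end

/-! Write `X_i = H_i + U_i`. Three independent estimates are needed.

Denoising. Since `l ≠ i, j`, expanding `⟨X_i - X_j, X_l⟩ - ⟨H_i - H_j, H_l⟩` leaves six cross terms,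
each of the form `⟨U, H⟩` or `⟨U, U'⟩` with distinct columns; no squared error norm appears. Given
the latent objects, each is a sum of at most `p` independent centred variables with a bounded moment
of order `2 + ν`, so a Fuk–Nagaev inequality (`measureReal_le_abs_sum_le`) applies. At deviation `b
p a_n` its exponential part is of order `n⁻³`, and its truncation part survives the union bound over
`n²` pairs exactly because of the rate condition (`tendsto_sq_mul_tailBound`). The conditional
moment bound is random, so the argument is localised to an event of large probability on which it is
at most a constant `K`.

Upper bound. This is Cauchy–Schwarz: `‖H_i - H_j‖` is at most `C √p† ‖α_i - α_j‖` and `‖H_l‖` at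
most `C √p†`.

Lower bound. For distant pairs, identification gives `ρ ≥ Δ`, while `‖α_i - α_j‖` is at most the
diameter of `A`. For close pairs, `H_i - H_j` is nearly a tangent vector `∇η d`. By nondegeneracy of
the Gram matrix, and because `A` contains a ball, the function `z ↦ ⟨∇η d, η(z)⟩` varies on `A` by a
multiple of `p† ‖d‖`, so it is large at some point of `A` and, by the Lipschitz property, at all
points near it (`exists_forall_le_abs_inner`). With high probability some latent variable other than
`α_i`, `α_j` lies that near (`probTendsToOne_dense`), and its index serves as `l`. -/

noncomputable section

/-! ### Taylor estimates on a convex set -/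

section Smooth

variable {E : Type*} [NormedAddCommGroup E] [NormedSpace ℝ E] {A : Set E} {f : E → ℝ} {C : ℝ} {m : ℕ}

theorem abs_sub_le_of_iteratedFDerivWithin_le (hA : Convex ℝ A) (hf : ContDiffOn ℝ m f A)
    (hm : 2 ≤ m) (hud : UniqueDiffOn ℝ A)
    (hb : ∀ k ≤ m, ∀ x ∈ A, ‖iteratedFDerivWithin ℝ k f A x‖ ≤ C) {x y : E} (hx : x ∈ A)
    (hy : y ∈ A) : |f y - f x| ≤ C * ‖y - x‖ := by
  have hd : DifferentiableOn ℝ f A :=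
    hf.differentiableOn (by exact_mod_cast (show m ≠ 0 by omega))
  refine hA.norm_image_sub_le_of_norm_fderivWithin_le (𝕜 := ℝ) hd (fun z hz => ?_) hx hy
  rw [← norm_iteratedFDerivWithin_one f (hud z hz)]
  exact hb 1 (by omega) z hz

theorem norm_fderivWithin_le_of_iteratedFDerivWithin_le (hud : UniqueDiffOn ℝ A) (hm : 2 ≤ m)
    (hb : ∀ k ≤ m, ∀ x ∈ A, ‖iteratedFDerivWithin ℝ k f A x‖ ≤ C) {x : E} (hx : x ∈ A) :
    ‖fderivWithin ℝ f A x‖ ≤ C := by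
  rw [← norm_iteratedFDerivWithin_one f (hud x hx)]
  exact hb 1 (by omega) x hx

/-- The bound on the second derivative makes the first derivative `C`-Lipschitz on `A`; the mean
value inequality for `f` minus its linear part at `x` then gives the quadratic remainder. -/
theorem abs_sub_sub_fderivWithin_le (hA : Convex ℝ A) (hf : ContDiffOn ℝ m f A)
    (hm : 2 ≤ m) (hud : UniqueDiffOn ℝ A)
    (hb : ∀ k ≤ m, ∀ x ∈ A, ‖iteratedFDerivWithin ℝ k f A x‖ ≤ C) {x y : E} (hx : x ∈ A)
    (hy : y ∈ A) : |f y - f x - fderivWithin ℝ f A x (y - x)| ≤ C * ‖y - x‖ ^ 2 := by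
  have hd : DifferentiableOn ℝ f A :=
    hf.differentiableOn (by exact_mod_cast (show m ≠ 0 by omega))
  have hf2 : ContDiffOn ℝ (1 + 1 : ℕ) f A := hf.of_le (by exact_mod_cast hm)
  have hdd : DifferentiableOn ℝ (fderivWithin ℝ f A) A :=
    (hf2.fderivWithin (m := 1) hud (by norm_num)).differentiableOn (by norm_num)
  have hC : 0 ≤ C := (norm_nonneg _).trans (hb 0 (by omega) x hx)
  have hlip : ∀ z ∈ A, ‖fderivWithin ℝ f A z - fderivWithin ℝ f A x‖ ≤ C * ‖z - x‖ := by
    intro z hz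
    refine hA.norm_image_sub_le_of_norm_fderivWithin_le (𝕜 := ℝ) hdd (fun w hw => ?_) hx hz
    rw [← norm_iteratedFDerivWithin_one _ (hud w hw), norm_iteratedFDerivWithin_fderivWithin hud hw]
    exact hb 2 hm w hw
  -- Intersecting with the ball keeps convexity and bounds the variation of the derivative uniformly
  -- by `C * ‖y - x‖`.
  have := (hA.inter (convex_closedBall x ‖y - x‖)).norm_image_sub_le_of_norm_hasFDerivWithin_le'
    (𝕜 := ℝ) (f := f) (f' := fun z => fderivWithin ℝ f A z) (φ := fderivWithin ℝ f A x)
    (C := C * ‖y - x‖) (x := x) (y := y)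
    (fun z hz => ((hd z hz.1).hasFDerivWithinAt).mono Set.inter_subset_left)
    (fun z hz => (hlip z hz.1).trans (by
      have := mem_closedBall_iff_norm.1 hz.2
      gcongr)) ⟨hx, Metric.mem_closedBall_self (norm_nonneg _)⟩
      ⟨hy, mem_closedBall_iff_norm.2 le_rfl⟩
  calc _ ≤ C * ‖y - x‖ * ‖y - x‖ := this
    _ = _ := by ring

end Smooth

/-! ### Geometry of the latent surface -/

/-- In an eigenbasis of `T* T` the squared norm of `T v` is the sum of the squared coordinates of
`v` weighted by squared singular values, the last of which is the smallest. -/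
theorem mul_norm_le_norm_toEuclideanLin {r : ℕ} (hr : 0 < r) {G : Matrix (Fin r) (Fin r) ℝ}
    {c : ℝ} (hc : 0 ≤ c) (h : c ≤ sMin G) (v : EuclideanSpace ℝ (Fin r)) :
    c * ‖v‖ ≤ ‖Matrix.toEuclideanLin G v‖ := by
  set T := Matrix.toEuclideanLin G
  have hn : Module.finrank ℝ (EuclideanSpace ℝ (Fin r)) = r := by simp
  have hS := T.isSymmetric_adjoint_comp_self
  set b := hS.eigenvectorBasis hn
  have hev : ∀ i, c ^ 2 ≤ hS.eigenvalues hn i := by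
    intro i
    rw [← T.sq_singularValues_fin hn i]
    have : T.singularValues (r - 1) ≤ T.singularValues i :=
      T.singularValues_antitone (by have := i.2; omega)
    exact pow_le_pow_left₀ hc (h.trans this) 2
  have h1 : ‖T v‖ ^ 2 = ∑ i, hS.eigenvalues hn i * (b.repr v i) ^ 2 := by
    rw [← real_inner_self_eq_norm_sq, ← LinearMap.adjoint_inner_right, ← b.sum_inner_mul_inner]
    refine Finset.sum_congr rfl fun i _ => ?_
    have : inner ℝ (b i) ((LinearMap.adjoint T) (T v)) = hS.eigenvalues hn i * b.repr v i := by
      rw [b.repr_apply_apply]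
      have h2 := hS (b i) v
      have h3 := hS.apply_eigenvectorBasis hn i
      rw [LinearMap.comp_apply, LinearMap.comp_apply] at h2
      change inner ℝ (b i) (LinearMap.adjoint T (T v)) = _
      rw [← h2]
      rw [LinearMap.comp_apply] at h3
      change inner ℝ (LinearMap.adjoint T (T (hS.eigenvectorBasis hn i))) v = _
      rw [h3, inner_smul_left]; rfl
    rw [this, b.repr_apply_apply, real_inner_comm]; ring
  have h2 : ‖v‖ ^ 2 = ∑ i, (b.repr v i) ^ 2 := by
    rw [← b.repr.norm_map v, EuclideanSpace.norm_sq_eq]; simp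
  refine le_of_sq_le_sq ?_ (norm_nonneg _)
  rw [mul_pow, h1, h2, Finset.mul_sum]
  exact Finset.sum_le_sum fun i _ => mul_le_mul_of_nonneg_right (hev i) (sq_nonneg _)

theorem EuclideanSpace.norm_le_mul_sqrt_card {ι : Type*} [Fintype ι] {v : EuclideanSpace ℝ ι} {b : ℝ}
    (hb : 0 ≤ b) (h : ∀ l, |v l| ≤ b) : ‖v‖ ≤ b * √(Fintype.card ι) := by
  rw [EuclideanSpace.norm_eq, ← Real.sqrt_sq hb, ← Real.sqrt_mul (sq_nonneg b)]
  refine Real.sqrt_le_sqrt ?_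
  calc ∑ i, ‖v i‖ ^ 2 ≤ ∑ _i : ι, b ^ 2 :=
        Finset.sum_le_sum fun i _ => pow_le_pow_left₀ (norm_nonneg _) (h i) 2
    _ = _ := by simp [mul_comm]

/-- The functions `g l` are `m ≥ 2` times continuously differentiable on `A`, with derivatives
bounded by `C`. -/
def SmoothFamily {ι : Type*} {r : ℕ} (A : Set (EuclideanSpace ℝ (Fin r))) (m : ℕ) (C : ℝ)
    (g : ι → EuclideanSpace ℝ (Fin r) → ℝ) : Prop :=
  ∀ l, ContDiffOn ℝ m (g l) A ∧ ∀ k ≤ m, ∀ x ∈ A, ‖iteratedFDerivWithin ℝ k (g l) A x‖ ≤ C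

namespace SmoothFamily

variable {ι : Type*} [Fintype ι] {r : ℕ} {A : Set (EuclideanSpace ℝ (Fin r))} {m : ℕ} {C : ℝ}
  {g : ι → EuclideanSpace ℝ (Fin r) → ℝ}

theorem abs_le {ι : Type*} {g : ι → EuclideanSpace ℝ (Fin r) → ℝ} (hg : SmoothFamily A m C g)
    (l : ι) {x} (hx : x ∈ A) : |g l x| ≤ C := by
  simpa using (hg l).2 0 (Nat.zero_le _) x hx

theorem norm_toLp_le (hg : SmoothFamily A m C g) (hC : 0 ≤ C) {x} (hx : x ∈ A) :
    ‖(WithLp.toLp 2 fun l => g l x : EuclideanSpace ℝ ι)‖ ≤ C * √(Fintype.card ι) :=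
  EuclideanSpace.norm_le_mul_sqrt_card hC fun l => hg.abs_le l hx

theorem norm_toLp_sub_le (hg : SmoothFamily A m C g) (hC : 0 ≤ C) (hm : 2 ≤ m) (hA : Convex ℝ A)
    (hud : UniqueDiffOn ℝ A) {x y} (hx : x ∈ A) (hy : y ∈ A) :
    ‖(WithLp.toLp 2 fun l => g l y : EuclideanSpace ℝ ι) - WithLp.toLp 2 fun l => g l x‖ ≤
      C * ‖y - x‖ * √(Fintype.card ι) :=
  EuclideanSpace.norm_le_mul_sqrt_card (by positivity) fun l =>
    abs_sub_le_of_iteratedFDerivWithin_le hA (hg l).1 hm hud (hg l).2 hx hy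

theorem norm_fderivWithin_toLp_le (hg : SmoothFamily A m C g) (hC : 0 ≤ C) (hm : 2 ≤ m)
    (hud : UniqueDiffOn ℝ A) {x} (hx : x ∈ A) (d : EuclideanSpace ℝ (Fin r)) :
    ‖(WithLp.toLp 2 fun l => fderivWithin ℝ (g l) A x d : EuclideanSpace ℝ ι)‖ ≤
      C * ‖d‖ * √(Fintype.card ι) :=
  EuclideanSpace.norm_le_mul_sqrt_card (by positivity) fun l =>
    (ContinuousLinearMap.le_opNorm _ _).trans (mul_le_mul_of_nonneg_right
      (norm_fderivWithin_le_of_iteratedFDerivWithin_le hud hm (hg l).2 hx) (norm_nonneg _))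

theorem norm_remainder_le (hg : SmoothFamily A m C g) (hC : 0 ≤ C) (hm : 2 ≤ m) (hA : Convex ℝ A)
    (hud : UniqueDiffOn ℝ A) {x y} (hx : x ∈ A) (hy : y ∈ A) :
    ‖(WithLp.toLp 2 fun l => g l y : EuclideanSpace ℝ ι) - (WithLp.toLp 2 fun l => g l x) -
      WithLp.toLp 2 fun l => fderivWithin ℝ (g l) A x (y - x)‖ ≤
      C * ‖y - x‖ ^ 2 * √(Fintype.card ι) :=
  EuclideanSpace.norm_le_mul_sqrt_card (by positivity) fun l =>
    abs_sub_sub_fderivWithin_le hA (hg l).1 hm hud (hg l).2 hx hy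

end SmoothFamily

/-- Transfers inner products of directional derivatives, which live in a space of growing dimension,
to the fixed space `ℝ^r`, where the nondegeneracy hypothesis is stated. -/
theorem inner_gram {ι : Type*} [Fintype ι] {r : ℕ}
    (L : ι → EuclideanSpace ℝ (Fin r) →L[ℝ] ℝ) (J : Matrix ι (Fin r) ℝ)
    (hJ : ∀ l j, J l j = L l (EuclideanSpace.single j 1)) {N : ℝ} (hN : 0 < N)
    (v w : EuclideanSpace ℝ (Fin r)) :
    inner ℝ (WithLp.toLp 2 fun l => L l v : EuclideanSpace ℝ ι) (WithLp.toLp 2 fun l => L l w) =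
      N * inner ℝ (Matrix.toEuclideanLin ((1 / N) • (J.transpose * J)) v) w := by
  have hL : ∀ u : EuclideanSpace ℝ (Fin r), (fun l => L l u) = J.mulVec u.ofLp := by
    intro u; ext l
    have hu : u = ∑ j, u j • EuclideanSpace.single j (1 : ℝ) := by
      simpa using ((EuclideanSpace.basisFun (Fin r) ℝ).sum_repr u).symm
    conv_lhs => rw [hu]
    simp [Matrix.mulVec, dotProduct, hJ, mul_comm]
  rw [hL v, hL w, map_smul, LinearMap.smul_apply, inner_smul_left]
  simp only [Matrix.toLpLin_apply, EuclideanSpace.inner_eq_star_dotProduct, star_trivial,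
    ← Matrix.mulVec_mulVec]
  rw [Matrix.mulVec_transpose, dotProduct_comm w.ofLp, ← Matrix.dotProduct_mulVec,
    dotProduct_comm (J.mulVec w.ofLp)]
  simp only [conj_trivial]
  field_simp

/-- Where the Jacobian of a smooth family is nondegenerate, differences in any direction are
detected by the inner product with a point of the surface, and by all points close to it. -/
theorem exists_forall_le_abs_inner {r : ℕ} {A : Set (EuclideanSpace ℝ (Fin r))}
    (hAc : IsCompact A) (hA : Convex ℝ A) (hint : (interior A).Nonempty) (m : ℕ) (hm : 2 ≤ m)
    (C : ℝ) (hC : 0 ≤ C) {c : ℝ} (hc : 0 < c) :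
    ∃ κ > 0, ∃ δ > 0, ∃ b > 0, ∀ (ι : Type) [Fintype ι] (g : ι → EuclideanSpace ℝ (Fin r) → ℝ)
      (N : ℝ), N = Fintype.card ι → 0 < N → SmoothFamily A m C g → ∀ x ∈ A, ∀ y ∈ A,
      ‖y - x‖ ≤ δ → ∀ J : Matrix ι (Fin r) ℝ,
      (∀ l j, J l j = fderivWithin ℝ (g l) A x (EuclideanSpace.single j 1)) →
      (∀ v, c * ‖v‖ ≤ ‖Matrix.toEuclideanLin ((1 / N) • (J.transpose * J)) v‖) →
      ∃ z ∈ A, ∀ z' ∈ A, ‖z' - z‖ ≤ κ → b * N * ‖y - x‖ ≤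
        |inner ℝ ((WithLp.toLp 2 fun l => g l y : EuclideanSpace ℝ ι) - WithLp.toLp 2 fun l => g l x)
          (WithLp.toLp 2 fun l => g l z')| := by
  have hud : UniqueDiffOn ℝ A := uniqueDiffOn_convex hA hint
  obtain ⟨x₀, hx₀⟩ := hint
  obtain ⟨ρ, hρ, hball⟩ := Metric.nhds_basis_closedBall.mem_iff.1 (mem_interior_iff_mem_nhds.1 hx₀)
  obtain ⟨B, hB⟩ := Metric.isBounded_iff.1 hAc.isBounded
  have hB0 : 0 ≤ B := by
    have := hB (interior_subset hx₀) (interior_subset hx₀)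
    simpa using this
  -- A step so short that the second-order remainder, of order `t ^ 2`, is at most half the
  -- first-order gain `t * ρ * c`.
  set t : ℝ := min 1 (ρ * c / (2 * (C ^ 2 * B ^ 2 + 1))) with ht
  have htpos : 0 < t := lt_min one_pos (by positivity)
  have ht1 : t ≤ 1 := min_le_left _ _
  have htB : C ^ 2 * B ^ 2 * t ≤ ρ * c / 2 := by
    have h1 : t ≤ ρ * c / (2 * (C ^ 2 * B ^ 2 + 1)) := min_le_right _ _
    rw [le_div_iff₀ (by positivity)] at h1
    nlinarith
  set b : ℝ := t * ρ * c / 4 with hb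
  have hbpos : 0 < b := by positivity
  -- The two radii are chosen so that moving `z` to `z'` and replacing the tangent vector by the
  -- true difference each cost at most `b / 4`; this leaves `b / 2`.
  refine ⟨b / (4 * (C ^ 2 + 1)), by positivity, b / (4 * (C ^ 2 + 1)), by positivity, b / 2,
    by positivity, ?_⟩
  intro ι _ g N hN hNpos hg x hx y hy hxy J hJ hG
  set d := y - x with hd
  set gv : EuclideanSpace ℝ (Fin r) → EuclideanSpace ℝ ι := fun z => WithLp.toLp 2 fun l => g l z
    with hgv
  set D : EuclideanSpace ℝ (Fin r) → EuclideanSpace ℝ ι :=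
    fun v => WithLp.toLp 2 fun l => fderivWithin ℝ (g l) A x v with hD
  have hsq : √(N : ℝ) * √N = N := Real.mul_self_sqrt hNpos.le
  have hDd : ‖D d‖ ≤ C * ‖d‖ * √N := hN ▸ hg.norm_fderivWithin_toLp_le hC hm hud hx d
  set u := Matrix.toEuclideanLin ((1 / N) • (J.transpose * J)) d with hu
  have hgram : ∀ w, inner ℝ (D d) (D w) = N * inner ℝ u w := fun w =>
    inner_gram (fun l => fderivWithin ℝ (g l) A x) J hJ hNpos d w
  have hmain : ∃ z ∈ A, b * N * ‖d‖ ≤ |inner ℝ (D d) (gv z)| := by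
    -- The ball of radius `ρ` about `x₀` lies in `A`. Moving from `x₀` by `±ρ u / ‖u‖`, with the
    -- sign of `⟨u, x₀ - x⟩`, adds `ρ ‖u‖` without cancellation.
    obtain ⟨z', hz', hz'u⟩ : ∃ z' ∈ A, ρ * ‖u‖ ≤ |inner ℝ u (z' - x)| := by
      by_cases hu0 : u = 0
      · exact ⟨x, hx, by simp [hu0]⟩
      have hunorm : 0 < ‖u‖ := norm_pos_iff.2 hu0
      set e := (ρ / ‖u‖) • u with he
      have hen : ‖e‖ = ρ := by
        rw [he, norm_smul, Real.norm_of_nonneg (by positivity)]; field_simp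
      have hue : inner ℝ u e = ρ * ‖u‖ := by
        rw [he, inner_smul_right, real_inner_self_eq_norm_sq]; field_simp
      rcases le_total 0 (inner ℝ u (x₀ - x)) with h | h
      · refine ⟨x₀ + e, hball (by simp [hen]), ?_⟩
        rw [show x₀ + e - x = (x₀ - x) + e by abel, inner_add_right, hue]
        exact le_trans (by linarith) (le_abs_self _)
      · refine ⟨x₀ - e, hball (by simp [hen]), ?_⟩
        rw [show x₀ - e - x = (x₀ - x) - e by abel, inner_sub_right, hue]
        exact le_trans (by linarith) (neg_le_abs _)
    set z := x + t • (z' - x) with hz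
    have hzA : z ∈ A := hA.add_smul_sub_mem hx hz' ⟨htpos.le, ht1⟩
    have hzx : z - x = t • (z' - x) := by simp [hz]
    have hzxn : ‖z - x‖ ≤ t * B := by
      rw [hzx, norm_smul, Real.norm_of_nonneg htpos.le]
      have := hB hz' hx
      rw [dist_eq_norm] at this
      gcongr
    have hrem : ‖gv z - gv x - D (z - x)‖ ≤ C * (t * B) ^ 2 * √N := by
      refine (hN ▸ hg.norm_remainder_le hC hm hA hud hx hzA :
        ‖gv z - gv x - D (z - x)‖ ≤ C * ‖z - x‖ ^ 2 * √N).trans ?_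
      gcongr
    have h1 : N * (t * (ρ * (c * ‖d‖))) ≤ |inner ℝ (D d) (D (z - x))| := by
      rw [hgram, hzx, inner_smul_right, abs_mul, abs_mul, abs_of_pos hNpos, abs_of_pos htpos]
      have := hG d
      gcongr
      exact le_trans (by gcongr) hz'u
    have h2 : |inner ℝ (D d) (gv z - gv x - D (z - x))| ≤
        (C * ‖d‖ * √N) * (C * (t * B) ^ 2 * √N) :=
      (abs_real_inner_le_norm _ _).trans (mul_le_mul hDd hrem (norm_nonneg _) (by positivity))
    have h3 : (C * ‖d‖ * √N) * (C * (t * B) ^ 2 * √N) ≤ N * (t * (ρ * c / 2) * ‖d‖) := by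
      calc _ = (√N * √N) * (t * (C ^ 2 * B ^ 2 * t) * ‖d‖) := by ring
        _ ≤ _ := by rw [hsq]; gcongr
    have h4 : inner ℝ (D d) (gv z) - inner ℝ (D d) (gv x) =
        inner ℝ (D d) (D (z - x)) + inner ℝ (D d) (gv z - gv x - D (z - x)) := by
      rw [← inner_sub_right, ← inner_add_right]; congr 1; abel
    -- The inner products of `D d` with `gv z` and with `gv x` differ by at least `t * ρ * c / 2`
    -- times `N * ‖d‖`, so they cannot both be below half of that in absolute value: either `z` or
    -- `x` itself is the witness.
    by_contra! hcon
    have h5 := hcon z hzA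
    have h6 := hcon x hx
    have h7 : |inner ℝ (D d) (D (z - x))| ≤ |inner ℝ (D d) (gv z)| + |inner ℝ (D d) (gv x)| +
        |inner ℝ (D d) (gv z - gv x - D (z - x))| := by
      have : inner ℝ (D d) (D (z - x)) = inner ℝ (D d) (gv z) - inner ℝ (D d) (gv x) -
        inner ℝ (D d) (gv z - gv x - D (z - x)) := by linarith
      rw [this]
      exact (abs_sub _ _).trans (add_le_add_left (abs_sub _ _) _)
    have h8 : b * N * ‖d‖ = N * (t * (ρ * c / 4) * ‖d‖) := by rw [hb]; ring
    nlinarith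
  obtain ⟨z, hzA, hz⟩ := hmain
  refine ⟨z, hzA, fun z' hz'A hzz' => ?_⟩
  have hκ : C ^ 2 * (b / (4 * (C ^ 2 + 1))) ≤ b / 4 := by
    rw [← mul_div_assoc, div_le_div_iff₀ (by positivity) (by norm_num)]
    nlinarith
  have h1 : |inner ℝ (D d) (gv z' - gv z)| ≤ (C * ‖d‖ * √N) * (C * (b / (4 * (C ^ 2 + 1))) * √N) := by
    refine (abs_real_inner_le_norm _ _).trans (mul_le_mul hDd ?_ (norm_nonneg _) (by positivity))
    refine (hN ▸ hg.norm_toLp_sub_le hC hm hA hud hzA hz'A :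
      ‖gv z' - gv z‖ ≤ C * ‖z' - z‖ * √N).trans ?_
    gcongr
  have h2 : |inner ℝ (gv y - gv x - D d) (gv z')| ≤
      (C * (‖d‖ * (b / (4 * (C ^ 2 + 1)))) * √N) * (C * √N) := by
    refine (abs_real_inner_le_norm _ _).trans (mul_le_mul ?_ ?_ (norm_nonneg _) (by positivity))
    · refine (hN ▸ hg.norm_remainder_le hC hm hA hud hx hy :
        ‖gv y - gv x - D (y - x)‖ ≤ C * ‖y - x‖ ^ 2 * √N).trans ?_
      rw [sq]; gcongr
    · exact hN ▸ hg.norm_toLp_le hC hz'A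
  have h3 : (C * ‖d‖ * √N) * (C * (b / (4 * (C ^ 2 + 1))) * √N) ≤ N * (b / 4 * ‖d‖) := by
    calc _ = (√N * √N) * ((C ^ 2 * (b / (4 * (C ^ 2 + 1)))) * ‖d‖) := by ring
      _ ≤ _ := by rw [hsq]; gcongr
  have h4 : (C * (‖d‖ * (b / (4 * (C ^ 2 + 1)))) * √N) * (C * √N) ≤ N * (b / 4 * ‖d‖) := by
    calc _ = (√N * √N) * ((C ^ 2 * (b / (4 * (C ^ 2 + 1)))) * ‖d‖) := by ring
      _ ≤ _ := by rw [hsq]; gcongr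
  have h5 : |inner ℝ (D d) (gv z)| ≤ |inner ℝ (gv y - gv x) (gv z')| +
      |inner ℝ (gv y - gv x - D d) (gv z')| + |inner ℝ (D d) (gv z' - gv z)| := by
    have : inner ℝ (D d) (gv z) = inner ℝ (gv y - gv x) (gv z') -
        inner ℝ (gv y - gv x - D d) (gv z') - inner ℝ (D d) (gv z' - gv z) := by
      rw [inner_sub_left (gv y - gv x), inner_sub_right]; ring
    rw [this]
    exact (abs_sub _ _).trans (add_le_add_left (abs_sub _ _) _)
  change b / 2 * N * ‖d‖ ≤ |inner ℝ (gv y - gv x) (gv z')|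
  nlinarith

/-! ### A Fuk–Nagaev tail inequality -/

/-- Up to `q` the quadratic term dominates. Beyond `q` the function `exp s / s ^ q` increases, so
its value at `s` is at most its value at `T`. -/
theorem Real.exp_le_one_add_add_sq_add_rpow {q s T : ℝ} (hq : 2 < q) (hT : 0 < T) (hs : s ≤ T) :
    Real.exp s ≤ 1 + s + Real.exp q * s ^ 2 + (|s| / T) ^ q * Real.exp T := by
  have hq1 : 1 ≤ Real.exp q := Real.one_le_exp (by linarith)
  have hnn : 0 ≤ (|s| / T) ^ q * Real.exp T := by positivity
  rcases le_or_gt s 1 with h1 | h1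
  · have : Real.exp s ≤ 1 + s + s ^ 2 := by
      rcases le_or_gt (-1) s with h2 | h2
      · have := Real.abs_exp_sub_one_sub_id_le (abs_le.2 ⟨h2, h1⟩)
        linarith [le_abs_self (Real.exp s - 1 - s)]
      · have : Real.exp s ≤ 1 := Real.exp_le_one_iff.2 (by linarith)
        nlinarith
    nlinarith [sq_nonneg s]
  · rcases le_or_gt s q with h2 | h2
    · have : Real.exp s ≤ Real.exp q := Real.exp_le_exp.2 h2
      nlinarith [mul_nonneg (Real.exp_pos q).le (by nlinarith : (0:ℝ) ≤ s ^ 2 - 1)]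
    · have hs0 : 0 < s := by linarith
      have key : Real.exp s ≤ (|s| / T) ^ q * Real.exp T := by
        rw [abs_of_pos hs0, Real.rpow_def_of_pos (by positivity), ← Real.exp_add]
        refine Real.exp_le_exp.2 ?_
        have hlog : Real.log (T / s) ≤ T / s - 1 := Real.log_le_sub_one_of_pos (by positivity)
        have hinv : Real.log (s / T) = - Real.log (T / s) := by
          rw [← Real.log_inv, inv_div]
        rw [hinv]
        have h3 : 0 ≤ T / s - 1 := by rw [sub_nonneg, le_div_iff₀ hs0]; linarith
        have h4 : Real.log (T / s) * q ≤ (T / s - 1) * s :=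
          (mul_le_mul_of_nonneg_right hlog (by linarith)).trans
            (mul_le_mul_of_nonneg_left h2.le h3)
        have h5 : (T / s - 1) * s = T - s := by field_simp
        linarith
      nlinarith [mul_nonneg (Real.exp_pos q).le (sq_nonneg s)]

theorem Real.sq_le_one_add_abs_rpow {q x : ℝ} (hq : 2 < q) : x ^ 2 ≤ 1 + |x| ^ q := by
  rcases le_or_gt |x| 1 with h | h
  · have : x ^ 2 ≤ 1 := (sq_le_one_iff_abs_le_one x).2 h
    have := Real.rpow_nonneg (abs_nonneg x) q
    linarith
  · have : |x| ^ (2 : ℝ) ≤ |x| ^ q := Real.rpow_le_rpow_of_exponent_le h.le hq.le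
    rw [Real.rpow_two, sq_abs] at this
    linarith

/-- The right side involves the untruncated `x`, so its linear term integrates to zero although `min
x y` is not centred. -/
theorem exp_mul_min_le {q t y x : ℝ} (hq : 2 < q) (ht : 0 < t) (hy : 0 < y) :
    Real.exp (t * min x y) ≤
      1 + t * x + Real.exp q * t ^ 2 * x ^ 2 + y ^ (-q) * Real.exp (t * y) * |x| ^ q := by
  have e : ∀ z : ℝ, (|t * z| / (t * y)) ^ q * Real.exp (t * y) =
      y ^ (-q) * Real.exp (t * y) * |z| ^ q := by
    intro z
    rw [abs_mul, abs_of_pos ht, mul_div_mul_left _ _ ht.ne', Real.div_rpow (abs_nonneg _) hy.le,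
      Real.rpow_neg hy.le]
    field_simp
  rcases le_total x y with h | h
  · rw [min_eq_left h]
    have := Real.exp_le_one_add_add_sq_add_rpow hq (mul_pos ht hy)
      (mul_le_mul_of_nonneg_left h ht.le)
    rw [e, mul_pow, ← mul_assoc] at this
    linarith
  · rw [min_eq_right h]
    have hx : 0 < x := hy.trans_le h
    have h1 : Real.exp (t * y) ≤ y ^ (-q) * Real.exp (t * y) * |x| ^ q := by
      rw [← e]
      have : 1 ≤ (|t * x| / (t * y)) ^ q := by
        refine Real.one_le_rpow ?_ (by linarith)
        rw [abs_of_pos (by positivity), one_le_div (by positivity)]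
        gcongr
      nlinarith [Real.exp_pos (t * y)]
    have : 0 ≤ 1 + t * x + Real.exp q * t ^ 2 * x ^ 2 := by positivity
    linarith

section Tail

variable {Ω : Type*} [MeasurableSpace Ω] {P : Measure Ω} [IsProbabilityMeasure P]

/-- A one-sided tail bound of Fuk–Nagaev type, for sums of independent centred variables with
a moment of order `q > 2`. -/
theorem measureReal_le_sum_le {ι : Type*} [Fintype ι] {v : ι → Ω → ℝ} (hind : iIndepFun v P)
    (hmeas : ∀ s, Measurable (v s)) (hint : ∀ s, Integrable (v s) P) (hmean : ∀ s, ∫ ω, v s ω ∂P = 0)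
    {q : ℝ} (hq : 2 < q) (hqint : ∀ s, Integrable (fun ω => |v s ω| ^ q) P) {K : ℝ}
    (hK : ∀ s, ∫ ω, |v s ω| ^ q ∂P ≤ K) {t y : ℝ} (ht : 0 < t) (hy : 0 < y) (x : ℝ) :
    P.real {ω | x ≤ ∑ s, v s ω} ≤ Fintype.card ι * (K * y ^ (-q)) + Real.exp (-t * x +
      Fintype.card ι * (Real.exp q * t ^ 2 * (1 + K) + y ^ (-q) * Real.exp (t * y) * K)) := by
  set w : ι → Ω → ℝ := fun s ω => min (v s ω) y with hw
  have hwmeas : ∀ s, Measurable (w s) := fun s => (hmeas s).min measurable_const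
  have hwind : iIndepFun w P := hind.comp (fun _ z => min z y) fun _ => by fun_prop
  -- Either some summand exceeds the level `y`, which Markov's inequality controls, or the truncated
  -- sum equals the original one, which Chernoff's bound controls.
  have hsub : {ω | x ≤ ∑ s, v s ω} ⊆ (⋃ s, {ω | y ^ q ≤ |v s ω| ^ q}) ∪
      {ω | x ≤ (∑ s, w s) ω} := by
    intro ω hω
    by_cases h : ∀ s, v s ω ≤ y
    · right
      have : ∀ s, w s ω = v s ω := fun s => min_eq_left (h s)
      simpa [this] using hω
    · left
      push Not at h
      obtain ⟨s, hs⟩ := h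
      exact Set.mem_iUnion.2 ⟨s, Real.rpow_le_rpow hy.le (hs.le.trans (le_abs_self _)) (by linarith)⟩
  have hmark : ∀ s, P.real {ω | y ^ q ≤ |v s ω| ^ q} ≤ K * y ^ (-q) := by
    intro s
    have := mul_meas_ge_le_integral_of_nonneg (μ := P) (f := fun ω => |v s ω| ^ q)
      (Eventually.of_forall fun ω => Real.rpow_nonneg (abs_nonneg _) q) (hqint s) (y ^ q)
    rw [Real.rpow_neg hy.le, ← div_eq_mul_inv, le_div_iff₀ (by positivity), mul_comm]
    exact this.trans (hK s)
  have hexpint : ∀ s, Integrable (fun ω => Real.exp (t * w s ω)) P := by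
    intro s
    refine Integrable.of_bound ((by fun_prop : Measurable fun ω => Real.exp (t * w s ω)).aestronglyMeasurable)
      (Real.exp (t * y)) (Eventually.of_forall fun ω => ?_)
    rw [Real.norm_of_nonneg (Real.exp_pos _).le]
    exact Real.exp_le_exp.2 (mul_le_mul_of_nonneg_left (min_le_right _ _) ht.le)
  have hsqint : ∀ s, Integrable (fun ω => v s ω ^ 2) P := fun s =>
    ((integrable_const 1).add (hqint s)).mono' ((hmeas s).pow_const 2).aestronglyMeasurable
      (Eventually.of_forall fun ω => by
        rw [Real.norm_of_nonneg (sq_nonneg _)]; exact Real.sq_le_one_add_abs_rpow hq)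
  have hsq : ∀ s, ∫ ω, v s ω ^ 2 ∂P ≤ 1 + K := by
    intro s
    calc ∫ ω, v s ω ^ 2 ∂P ≤ ∫ ω, (1 + |v s ω| ^ q) ∂P :=
          integral_mono (hsqint s) ((integrable_const 1).add (hqint s))
            fun ω => Real.sq_le_one_add_abs_rpow hq
      _ = 1 + ∫ ω, |v s ω| ^ q ∂P := by
          rw [integral_add (integrable_const 1) (hqint s)]; simp
      _ ≤ _ := by linarith [hK s]
  have hmgf : ∀ s, mgf (w s) P t ≤
      Real.exp (Real.exp q * t ^ 2 * (1 + K) + y ^ (-q) * Real.exp (t * y) * K) := by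
    intro s
    have i1 : Integrable (fun ω => 1 + t * v s ω) P :=
      (integrable_const 1).add ((hint s).const_mul t)
    have i2 : Integrable (fun ω => 1 + t * v s ω + Real.exp q * t ^ 2 * v s ω ^ 2) P :=
      i1.add ((hsqint s).const_mul _)
    have i3 : Integrable (fun ω => y ^ (-q) * Real.exp (t * y) * |v s ω| ^ q) P :=
      (hqint s).const_mul _
    calc mgf (w s) P t ≤ ∫ ω, (1 + t * v s ω + Real.exp q * t ^ 2 * v s ω ^ 2 +
          y ^ (-q) * Real.exp (t * y) * |v s ω| ^ q) ∂P :=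
          integral_mono (hexpint s) (i2.add i3) fun ω => exp_mul_min_le hq ht hy
      _ = 1 + Real.exp q * t ^ 2 * ∫ ω, v s ω ^ 2 ∂P +
          y ^ (-q) * Real.exp (t * y) * ∫ ω, |v s ω| ^ q ∂P := by
          rw [integral_add i2 i3, integral_add i1 ((hsqint s).const_mul _),
            integral_add (integrable_const 1) ((hint s).const_mul t), integral_const_mul,
            integral_const_mul, integral_const_mul, hmean s]
          simp
      _ ≤ 1 + Real.exp q * t ^ 2 * (1 + K) + y ^ (-q) * Real.exp (t * y) * K := by
          gcongr
          · exact hsq s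
          · exact hK s
      _ ≤ _ := by
          have := Real.add_one_le_exp
            (Real.exp q * t ^ 2 * (1 + K) + y ^ (-q) * Real.exp (t * y) * K)
          linarith
  have hchern : P.real {ω | x ≤ (∑ s, w s) ω} ≤ Real.exp (-t * x +
      Fintype.card ι * (Real.exp q * t ^ 2 * (1 + K) + y ^ (-q) * Real.exp (t * y) * K)) := by
    refine (measure_ge_le_exp_mul_mgf x ht.le
      (hwind.integrable_exp_mul_sum hwmeas fun s _ => hexpint s)).trans ?_
    rw [hwind.mgf_sum hwmeas, Real.exp_add]
    gcongr
    calc ∏ s, mgf (w s) P t ≤ ∏ _s : ι, Real.exp (Real.exp q * t ^ 2 * (1 + K) +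
          y ^ (-q) * Real.exp (t * y) * K) :=
          Finset.prod_le_prod (fun s _ => mgf_nonneg) fun s _ => hmgf s
      _ = _ := by rw [Finset.prod_const, ← Real.exp_nat_mul]; simp
  calc P.real {ω | x ≤ ∑ s, v s ω} ≤ P.real ((⋃ s, {ω | y ^ q ≤ |v s ω| ^ q}) ∪
        {ω | x ≤ (∑ s, w s) ω}) := measureReal_mono hsub
    _ ≤ P.real (⋃ s, {ω | y ^ q ≤ |v s ω| ^ q}) + P.real {ω | x ≤ (∑ s, w s) ω} :=
        measureReal_union_le _ _
    _ ≤ _ := by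
        refine add_le_add ?_ hchern
        refine (measureReal_iUnion_fintype_le _).trans ?_
        calc _ ≤ ∑ _s : ι, K * y ^ (-q) := Finset.sum_le_sum fun s _ => hmark s
          _ = _ := by simp

theorem measureReal_le_abs_sum_le {ι : Type*} [Fintype ι] {v : ι → Ω → ℝ} (hind : iIndepFun v P)
    (hmeas : ∀ s, Measurable (v s)) (hint : ∀ s, Integrable (v s) P) (hmean : ∀ s, ∫ ω, v s ω ∂P = 0)
    {q : ℝ} (hq : 2 < q) (hqint : ∀ s, Integrable (fun ω => |v s ω| ^ q) P) {K : ℝ}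
    (hK : ∀ s, ∫ ω, |v s ω| ^ q ∂P ≤ K) {t y : ℝ} (ht : 0 < t) (hy : 0 < y) (x : ℝ) :
    P.real {ω | x ≤ |∑ s, v s ω|} ≤ 2 * (Fintype.card ι * (K * y ^ (-q)) + Real.exp (-t * x +
      Fintype.card ι * (Real.exp q * t ^ 2 * (1 + K) + y ^ (-q) * Real.exp (t * y) * K))) := by
  have h1 := measureReal_le_sum_le hind hmeas hint hmean hq hqint hK ht hy x
  have h2 := measureReal_le_sum_le (v := fun s ω => -v s ω)
    (hind.comp (fun _ z => -z) fun _ => measurable_neg) (fun s => (hmeas s).neg)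
    (fun s => (hint s).neg) (fun s => by rw [integral_neg, hmean s, neg_zero]) hq
    (by simpa using hqint) (by simpa using hK) ht hy x
  have hsub : {ω | x ≤ |∑ s, v s ω|} ⊆ {ω | x ≤ ∑ s, v s ω} ∪ {ω | x ≤ ∑ s, -v s ω} := by
    intro ω hω
    rw [Set.mem_union, Set.mem_ofPred_eq, Set.mem_ofPred_eq, Finset.sum_neg_distrib]
    exact le_abs.1 hω
  have := (measureReal_mono hsub).trans (measureReal_union_le (μ := P) _ _)
  linarith

end Tail

/-! ### Weighted sums and sums of products of independent coordinates -/

/-- Injectivity of `Sum.elim a b` means that no coordinate is used twice, so rectangle probabilities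
factor, and rectangles form a generating π-system. This makes the products `Z (a s) * Z (b s)`
independent over `s`. -/
theorem ProbabilityTheory.iIndepFun.prodMk_of_injective {Ω ι κ : Type*} [MeasurableSpace Ω]
    {P : Measure Ω} {Z : ι → Ω → ℝ} (hZ : iIndepFun Z P) (hmeas : ∀ i, Measurable (Z i)) {a b : κ → ι}
    (hab : Function.Injective (Sum.elim a b)) :
    iIndepFun (fun s ω => (Z (a s) ω, Z (b s) ω)) P := by
  have hW := hZ.precomp hab
  have hinter : ∀ (S : Finset κ) (B C : κ → Set ℝ), (∀ s ∈ S, MeasurableSet (B s)) →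
      (∀ s ∈ S, MeasurableSet (C s)) →
      P (⋂ s ∈ S, (Z (a s) ⁻¹' B s ∩ Z (b s) ⁻¹' C s)) =
        (∏ s ∈ S, P (Z (a s) ⁻¹' B s)) * ∏ s ∈ S, P (Z (b s) ⁻¹' C s) := by
    intro S B C hB hC
    have := hW.measure_inter_preimage_eq_mul (S.disjSum S) (sets := Sum.elim B C) (by
      rintro (s | s) hs
      · exact hB s (by simpa using hs)
      · exact hC s (by simpa using hs))
    rw [Finset.prod_disjSum] at this
    simp only [Sum.elim_inl, Sum.elim_inr] at this
    rw [← this]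
    congr 1
    ext ω
    simp only [Set.mem_iInter, Finset.mem_disjSum, Set.mem_inter_iff, Set.mem_preimage]
    refine ⟨fun h => ?_, fun h s hs => ⟨h (.inl s) (.inl ⟨s, hs, rfl⟩), h (.inr s) (.inr ⟨s, hs, rfl⟩)⟩⟩
    rintro _ (⟨s, hs, rfl⟩ | ⟨s, hs, rfl⟩)
    exacts [(h s hs).1, (h s hs).2]
  set G : Set (Set (ℝ × ℝ)) := Set.image2 (· ×ˢ ·) {s | MeasurableSet s} {t | MeasurableSet t}
  refine iIndepSets.iIndep (fun s => ((hmeas (a s)).prodMk (hmeas (b s))).comap_le)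
    (fun s => Set.preimage (fun ω => (Z (a s) ω, Z (b s) ω)) '' G)
    (fun s => isPiSystem_prod.comap _) (fun s => ?_) ?_
  · rw [← MeasurableSpace.comap_generateFrom, generateFrom_prod]
  · rw [iIndepSets_iff]
    intro S f hf
    choose! t ht htf using hf
    choose! B hB C hC hBC using ht
    have key : ∀ s ∈ S, f s = Z (a s) ⁻¹' B s ∩ Z (b s) ⁻¹' C s := by
      intro s hs
      rw [← htf s hs, ← hBC s hs]; rfl
    have h1 : ∀ s ∈ S, P (f s) = P (Z (a s) ⁻¹' B s) * P (Z (b s) ⁻¹' C s) := by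
      intro s hs
      have := hinter {s} B C (by simpa using hB s hs) (by simpa using hC s hs)
      rw [key s hs]
      simpa using this
    rw [Finset.prod_congr rfl h1, Finset.prod_mul_distrib, ← hinter S B C hB hC]
    congr 1
    exact Set.iInter₂_congr key

section IndependentCoordinates

variable {Ω ι κ : Type*} [MeasurableSpace Ω] {P : Measure Ω} [IsProbabilityMeasure P] [Fintype κ]
  {Z : ι → Ω → ℝ} {q K : ℝ}

/-- Upper bound for the probability that a sum of `N` independent centred variables, with moments
of order `q` at most `K`, exceeds `x` in absolute value. -/
def tailBound (q K N t y x : ℝ) : ℝ :=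
  2 * (N * (K * y ^ (-q)) + Real.exp (-t * x +
    N * (Real.exp q * t ^ 2 * (1 + K) + y ^ (-q) * Real.exp (t * y) * K)))

theorem measureReal_le_abs_sum_mul_le (hZ : iIndepFun Z P) (hmeas : ∀ i, Measurable (Z i))
    (hint : ∀ i, Integrable (Z i) P) (hmean : ∀ i, ∫ ω, Z i ω ∂P = 0) (hq : 2 < q)
    (hqint : ∀ i, Integrable (fun ω => |Z i ω| ^ q) P) (hK : ∀ i, ∫ ω, |Z i ω| ^ q ∂P ≤ K)
    {a : κ → ι} (ha : Function.Injective a) {h : κ → ℝ} {C : ℝ} (hC : ∀ s, |h s| ≤ C)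
    {t y : ℝ} (ht : 0 < t) (hy : 0 < y) (x : ℝ) :
    P.real {ω | x ≤ |∑ s, Z (a s) ω * h s|} ≤ tailBound q (K * C ^ q) (Fintype.card κ) t y x := by
  have e : ∀ s ω, |Z (a s) ω * h s| ^ q = |Z (a s) ω| ^ q * |h s| ^ q := fun s ω => by
    rw [abs_mul, Real.mul_rpow (abs_nonneg _) (abs_nonneg _)]
  refine measureReal_le_abs_sum_le ((hZ.precomp ha).comp (fun s z => z * h s) fun s => by fun_prop)
    (fun s => (hmeas _).mul_const _) (fun s => (hint _).mul_const _)
    (fun s => by simp [integral_mul_const, hmean]) hq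
    (fun s => ?_) (fun s => ?_) ht hy x
  · simpa only [Function.comp_def, e] using (hqint (a s)).mul_const _
  · simp only [Function.comp_def, e, integral_mul_const]
    have h1 : |h s| ^ q ≤ C ^ q := Real.rpow_le_rpow (abs_nonneg _) (hC s) (by linarith)
    have h2 : 0 ≤ ∫ ω, |Z (a s) ω| ^ q ∂P := integral_nonneg fun ω => by positivity
    exact mul_le_mul (hK _) h1 (by positivity) (h2.trans (hK _))

/-- The two factors are independent, so the moment of order `q` of their product factors: moments of
order `q` suffice for the quadratic terms, with constant `K * K`. -/
theorem measureReal_le_abs_sum_mul_mul_le (hZ : iIndepFun Z P) (hmeas : ∀ i, Measurable (Z i))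
    (hint : ∀ i, Integrable (Z i) P) (hmean : ∀ i, ∫ ω, Z i ω ∂P = 0) (hq : 2 < q)
    (hqint : ∀ i, Integrable (fun ω => |Z i ω| ^ q) P) (hK : ∀ i, ∫ ω, |Z i ω| ^ q ∂P ≤ K)
    {a b : κ → ι} (hab : Function.Injective (Sum.elim a b))
    {t y : ℝ} (ht : 0 < t) (hy : 0 < y) (x : ℝ) :
    P.real {ω | x ≤ |∑ s, Z (a s) ω * Z (b s) ω|} ≤
      tailBound q (K * K) (Fintype.card κ) t y x := by
  have hpair : ∀ s, IndepFun (Z (a s)) (Z (b s)) P := fun s =>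
    hZ.indepFun fun h => by simpa using @hab (.inl s) (.inr s) h
  have hpair' : ∀ s, IndepFun (fun ω => |Z (a s) ω| ^ q) (fun ω => |Z (b s) ω| ^ q) P := fun s =>
    (hpair s).comp (φ := fun z => |z| ^ q) (ψ := fun z => |z| ^ q) (by fun_prop) (by fun_prop)
  have e : ∀ s ω, |Z (a s) ω * Z (b s) ω| ^ q = |Z (a s) ω| ^ q * |Z (b s) ω| ^ q := fun s ω => by
    rw [abs_mul, Real.mul_rpow (abs_nonneg _) (abs_nonneg _)]
  refine measureReal_le_abs_sum_le ((hZ.prodMk_of_injective hmeas hab).comp (fun s z => z.1 * z.2)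
    fun s => by fun_prop) (fun s => (hmeas _).mul (hmeas _))
    (fun s => (hpair s).integrable_mul (hint _) (hint _)) (fun s => ?_) hq
    (fun s => ?_) (fun s => ?_) ht hy x
  · have := (hpair s).integral_mul_eq_mul_integral (hint _).aestronglyMeasurable
      (hint _).aestronglyMeasurable
    simpa [hmean] using this
  · simpa only [Function.comp_def, e, Pi.mul_def] using (hpair' s).integrable_mul (hqint _) (hqint _)
  · simp only [Function.comp_def, e]
    have := (hpair' s).integral_mul_eq_mul_integral (hqint _).aestronglyMeasurable
      (hqint _).aestronglyMeasurable
    simp only [Pi.mul_def] at this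
    rw [this]
    have h2 : ∀ i, 0 ≤ ∫ ω, |Z i ω| ^ q ∂P := fun i => integral_nonneg fun ω => by positivity
    exact mul_le_mul (hK _) (hK _) (h2 _) ((h2 (a s)).trans (hK _))

end IndependentCoordinates

/-! ### Conditioning on the latent objects -/

section Conditional

variable {Ω β ι : Type*} [mΩ : MeasurableSpace Ω] [mβ : MeasurableSpace β] [Fintype ι]
  {μ : Measure Ω} [IsProbabilityMeasure μ] {X : Ω → β} {U : ι → Ω → ℝ}

/-- The regular conditional distribution of the family `U` given `X`. -/
abbrev condLaw (μ : Measure Ω) [IsProbabilityMeasure μ] (X : Ω → β) (U : ι → Ω → ℝ) :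
    Kernel β (ι → ℝ) :=
  condDistrib (fun ω i => U i ω) X μ

/-- Conditional independence holds for each choice of Borel sets outside its own null set. Boxes
with rational endpoints are countably many and determine a finite-dimensional law, so one null set
suffices. -/
theorem ae_condLaw_eq_pi (hX : Measurable X) (hU : ∀ i, Measurable (U i))
    (hind : CondIndepFamily μ (mβ.comap X) U) :
    ∀ᵐ ω ∂μ, condLaw μ X U (X ω) = Measure.pi fun i => (condLaw μ X U (X ω)).map fun z => z i := by
  have hUm : Measurable fun ω i => U i ω := measurable_pi_lambda _ hU
  have key : ∀ ab : ι → ℚ × ℚ, ∀ᵐ ω ∂μ, (condLaw μ X U (X ω)).real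
      (⋂ i ∈ Finset.univ, (fun z : ι → ℝ => z i) ⁻¹' Set.Ioo ((ab i).1 : ℝ) (ab i).2) =
      ∏ i, (condLaw μ X U (X ω)).real ((fun z : ι → ℝ => z i) ⁻¹' Set.Ioo ((ab i).1 : ℝ) (ab i).2) := by
    intro ab
    have hm : ∀ i, MeasurableSet ((fun z : ι → ℝ => z i) ⁻¹' Set.Ioo ((ab i).1 : ℝ) (ab i).2) :=
      fun i => measurable_pi_apply i measurableSet_Ioo
    have h1 := condDistrib_ae_eq_condExp (μ := μ) hX hUm
      (Finset.univ.measurableSet_biInter fun i _ => hm i)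
    have h2 : ∀ i, _ := fun i => condDistrib_ae_eq_condExp (μ := μ) hX hUm (hm i)
    have h3 := hind Finset.univ (fun i => Set.Ioo ((ab i).1 : ℝ) (ab i).2)
      fun i _ => measurableSet_Ioo
    filter_upwards [h1, ae_all_iff.2 h2, h3] with ω h1 h2 h3
    rw [h1, Finset.prod_congr rfl fun i _ => h2 i]
    rw [Finset.prod_apply] at h3
    convert h3 using 2
    · simp only [Set.preimage_iInter]
      rfl
    · rfl
  filter_upwards [ae_all_iff.2 key] with ω hω
  set P := condLaw μ X U (X ω)
  have hprob : ∀ i, IsProbabilityMeasure (P.map fun z => z i) := fun i =>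
    Measure.isProbabilityMeasure_map (measurable_pi_apply i).aemeasurable
  symm
  refine Measure.pi_eq_generateFrom (fun _ => Real.borel_eq_generateFrom_Ioo_rat.symm)
    (fun _ => Real.isPiSystem_Ioo_rat) (fun _ => Real.finiteSpanningSetsInIooRat _) fun s hs => ?_
  simp only [Set.mem_iUnion, Set.mem_singleton_iff] at hs
  choose a b _ hs using hs
  have := hω fun i => (a i, b i)
  obtain rfl : s = fun i => Set.Ioo (a i : ℝ) (b i) := funext hs
  rw [← ENNReal.toReal_eq_toReal_iff' (measure_ne_top _ _)
    (ENNReal.prod_ne_top fun i _ => measure_ne_top _ _), ENNReal.toReal_prod]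
  have hset : Set.univ.pi (fun i => Set.Ioo (a i : ℝ) (b i)) =
      ⋂ i ∈ Finset.univ, (fun z : ι → ℝ => z i) ⁻¹' Set.Ioo (a i : ℝ) (b i) := by
    ext z; simp [Set.mem_pi]
  rw [hset]
  refine this.trans (Finset.prod_congr rfl fun i _ => ?_)
  rw [Measure.map_apply (measurable_pi_apply i) measurableSet_Ioo]; rfl

theorem ae_iIndepFun_condLaw (hX : Measurable X) (hU : ∀ i, Measurable (U i))
    (hind : CondIndepFamily μ (mβ.comap X) U) :
    ∀ᵐ ω ∂μ, iIndepFun (fun i (z : ι → ℝ) => z i) (condLaw μ X U (X ω)) := by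
  filter_upwards [ae_condLaw_eq_pi hX hU hind] with ω hω
  rw [iIndepFun_iff_map_fun_eq_pi_map fun i => (measurable_pi_apply i).aemeasurable]
  rw [← hω]
  exact Measure.map_id

theorem measure_preimage_prodMk_eq_lintegral_condLaw (hX : Measurable X) (hU : ∀ i, Measurable (U i))
    {S : Set (β × (ι → ℝ))} (hS : MeasurableSet S) :
    μ {ω | (X ω, fun i => U i ω) ∈ S} =
      ∫⁻ ω, condLaw μ X U (X ω) (Prod.mk (X ω) ⁻¹' S) ∂μ := by
  have hUm : Measurable fun ω i => U i ω := measurable_pi_lambda _ hU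
  rw [← lintegral_map (f := fun b => condLaw μ X U b (Prod.mk b ⁻¹' S))
    (Kernel.measurable_kernel_prodMk_left hS) hX,
    ← Measure.compProd_apply hS, compProd_map_condDistrib hUm.aemeasurable,
    Measure.map_apply (hX.prodMk hUm) hS]
  rfl

/-- Turns the hypothesis on conditional moments into a bound on the moments of the coordinates under
the conditional law. -/
theorem ae_condLExp_eq_lintegral_condLaw (hX : Measurable X) (hU : ∀ i, Measurable (U i)) (i : ι)
    {f : ℝ → ℝ≥0∞} (hf : Measurable f) :
    ∀ᵐ ω ∂μ, ∫⁻ z, f (z i) ∂condLaw μ X U (X ω) = condLExp (mβ.comap X) μ (fun ω => f (U i ω)) ω := by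
  have hUm : Measurable fun ω i => U i ω := measurable_pi_lambda _ hU
  have hfi : Measurable fun z : ι → ℝ => f (z i) := hf.comp (measurable_pi_apply i)
  refine ae_eq_condLExp (hm := hX.comap_le) μ _
    ((hfi.lintegral_kernel (κ := condLaw μ X U)).comp (Measurable.of_comap_le le_rfl)) ?_
  rintro _ ⟨t, ht, rfl⟩
  have hf2 : Measurable fun x : β × (ι → ℝ) => f (x.2 i) := hfi.comp measurable_snd
  have h1 := Measure.setLIntegral_compProd (μ := μ.map X) (κ := condLaw μ X U)
    (f := fun x : β × (ι → ℝ) => f (x.2 i)) hf2 ht MeasurableSet.univ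
  rw [compProd_map_condDistrib hUm.aemeasurable, setLIntegral_map (ht.prod MeasurableSet.univ)
    hf2 (hX.prodMk hUm)] at h1
  simp only [Measure.restrict_univ] at h1
  rw [setLIntegral_map ht hfi.lintegral_kernel hX] at h1
  rw [Set.mk_preimage_prod, Set.preimage_univ, Set.inter_univ] at h1
  exact h1.symm

theorem ae_integral_condLaw_eq_zero (hX : Measurable X) (hU : ∀ i, Measurable (U i)) (i : ι)
    (hint : Integrable (U i) μ) (hmean : μ[U i | mβ.comap X] =ᵐ[μ] 0) :
    ∀ᵐ ω ∂μ, ∫ z, z i ∂condLaw μ X U (X ω) = 0 := by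
  have hUm : Measurable fun ω i => U i ω := measurable_pi_lambda _ hU
  have := condExp_ae_eq_integral_condDistrib (μ := μ) hX hUm.aemeasurable (f := fun z => z i)
    (measurable_pi_apply i).stronglyMeasurable hint
  filter_upwards [this, hmean] with ω h1 h2
  exact h1.symm.trans h2

end Conditional

section Conditional

variable {Ω β ι : Type*} [mΩ : MeasurableSpace Ω] [mβ : MeasurableSpace β] [Fintype ι]
  {μ : Measure Ω} [IsProbabilityMeasure μ] {X : Ω → β} {U : ι → Ω → ℝ}

theorem measure_le_of_forall_condLaw_le (hX : Measurable X) (hU : ∀ i, Measurable (U i))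
    {T : Set (β × (ι → ℝ))} (hT : MeasurableSet T) {B : ℝ≥0∞}
    (hB : ∀ᵐ ω ∂μ, condLaw μ X U (X ω) (Prod.mk (X ω) ⁻¹' T) ≤ B) :
    μ {ω | (X ω, fun i => U i ω) ∈ T} ≤ B := by
  rw [measure_preimage_prodMk_eq_lintegral_condLaw hX hU hT]
  refine (lintegral_mono_ae hB).trans ?_
  simp

/-- The values of `X` at which all conditional moments of order `q` are at most `K`. -/
def momentSet (μ : Measure Ω) [IsProbabilityMeasure μ] (X : Ω → β) (U : ι → Ω → ℝ) (q K : ℝ) :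
    Set β :=
  {b | ∀ i, ∫⁻ z, ENNReal.ofReal (|z i| ^ q) ∂condLaw μ X U b ≤ ENNReal.ofReal K}

theorem measurableSet_momentSet (q K : ℝ) : MeasurableSet (momentSet μ X U q K) := by
  simp only [momentSet, Set.ofPred_forall]
  refine MeasurableSet.iInter fun i => measurableSet_le (Measurable.lintegral_kernel ?_)
    measurable_const
  fun_prop

theorem integrable_rpow_of_mem_momentSet {q K : ℝ} {b : β} (hb : b ∈ momentSet μ X U q K) (i : ι) :
    Integrable (fun z : ι → ℝ => |z i| ^ q) (condLaw μ X U b) := by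
  have hm : Measurable fun z : ι → ℝ => |z i| ^ q := by fun_prop
  refine ⟨hm.aestronglyMeasurable, ?_⟩
  rw [hasFiniteIntegral_iff_ofReal (Eventually.of_forall fun z => by positivity)]
  exact (hb i).trans_lt ENNReal.ofReal_lt_top

theorem integral_rpow_le_of_mem_momentSet {q K : ℝ} (hK : 0 ≤ K) {b : β}
    (hb : b ∈ momentSet μ X U q K) (i : ι) : ∫ z : ι → ℝ, |z i| ^ q ∂condLaw μ X U b ≤ K := by
  rw [integral_eq_lintegral_of_nonneg_ae (Eventually.of_forall fun z => by positivity)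
    (integrable_rpow_of_mem_momentSet hb i).aestronglyMeasurable]
  exact ENNReal.toReal_le_of_le_ofReal hK (hb i)

theorem integrable_of_mem_momentSet {q K : ℝ} (hq : 2 < q) {b : β}
    (hb : b ∈ momentSet μ X U q K) (i : ι) :
    Integrable (fun z : ι → ℝ => z i) (condLaw μ X U b) := by
  refine ((integrable_const 1).add (integrable_rpow_of_mem_momentSet hb i)).mono'
    (measurable_pi_apply i).aestronglyMeasurable (Eventually.of_forall fun z => ?_)
  have h1 := Real.sq_le_one_add_abs_rpow hq (x := z i)
  have h2 := Real.rpow_nonneg (abs_nonneg (z i)) q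
  change |z i| ≤ 1 + |z i| ^ q
  rcases le_total |z i| 1 with h | h
  · linarith
  · have := sq_abs (z i); nlinarith

variable {κ : Type*} [Fintype κ]

/-- Under the conditional law the weights are constants, so the unconditional tail bound applies
fibrewise. Including the moment and weight bounds in the event makes the remaining fibres empty. -/
theorem measure_abs_sum_mul_le (hX : Measurable X) (hU : ∀ i, Measurable (U i))
    (hind : CondIndepFamily μ (mβ.comap X) U) (hint : ∀ i, Integrable (U i) μ)
    (hmean : ∀ i, μ[U i | mβ.comap X] =ᵐ[μ] 0) {q K C : ℝ} (hq : 2 < q) (hK : 0 ≤ K)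
    {a : κ → ι} (ha : Function.Injective a) {h : κ → β → ℝ} (hh : ∀ s, Measurable (h s))
    {t y : ℝ} (ht : 0 < t) (hy : 0 < y) (x : ℝ) :
    μ {ω | X ω ∈ momentSet μ X U q K ∧ (∀ s, |h s (X ω)| ≤ C) ∧
      x ≤ |∑ s, U (a s) ω * h s (X ω)|} ≤
      ENNReal.ofReal (tailBound q (K * C ^ q) (Fintype.card κ) t y x) := by
  refine measure_le_of_forall_condLaw_le hX hU
    (T := {p | p.1 ∈ momentSet μ X U q K ∧ (∀ s, |h s p.1| ≤ C) ∧
      x ≤ |∑ s, p.2 (a s) * h s p.1|}) ?_ ?_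
  · refine (measurable_fst (measurableSet_momentSet q K)).inter (MeasurableSet.inter ?_ ?_)
    · change MeasurableSet {p : β × (ι → ℝ) | ∀ s, |h s p.1| ≤ C}
      rw [Set.ofPred_forall]
      exact MeasurableSet.iInter fun s => measurableSet_le (by fun_prop) measurable_const
    · refine measurableSet_le (g := fun p : β × (ι → ℝ) => |∑ s, p.2 (a s) * h s p.1|)
        measurable_const ?_
      fun_prop
  · filter_upwards [ae_iIndepFun_condLaw hX hU hind,
      ae_all_iff.2 fun i => ae_integral_condLaw_eq_zero hX hU i (hint i) (hmean i)] with ω h1 h2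
    by_cases hG : X ω ∈ momentSet μ X U q K ∧ ∀ s, |h s (X ω)| ≤ C
    · have := measureReal_le_abs_sum_mul_le h1 (fun i => measurable_pi_apply i)
        (integrable_of_mem_momentSet hq hG.1) h2 hq (integrable_rpow_of_mem_momentSet hG.1)
        (integral_rpow_le_of_mem_momentSet hK hG.1) ha hG.2 ht hy x
      refine le_trans (measure_mono (t := {z : ι → ℝ | x ≤ |∑ s, z (a s) * h s (X ω)|})
        fun z hz => hz.2.2) ?_
      rw [← ofReal_measureReal]
      exact ENNReal.ofReal_le_ofReal this
    · rw [measure_mono_null (t := ∅) (fun z hz => hG ⟨hz.1, hz.2.1⟩) measure_empty]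
      exact zero_le

theorem measure_abs_sum_mul_mul_le (hX : Measurable X) (hU : ∀ i, Measurable (U i))
    (hind : CondIndepFamily μ (mβ.comap X) U) (hint : ∀ i, Integrable (U i) μ)
    (hmean : ∀ i, μ[U i | mβ.comap X] =ᵐ[μ] 0) {q K : ℝ} (hq : 2 < q) (hK : 0 ≤ K)
    {a b : κ → ι} (hab : Function.Injective (Sum.elim a b))
    {t y : ℝ} (ht : 0 < t) (hy : 0 < y) (x : ℝ) :
    μ {ω | X ω ∈ momentSet μ X U q K ∧ x ≤ |∑ s, U (a s) ω * U (b s) ω|} ≤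
      ENNReal.ofReal (tailBound q (K * K) (Fintype.card κ) t y x) := by
  refine measure_le_of_forall_condLaw_le hX hU
    (T := {p | p.1 ∈ momentSet μ X U q K ∧ x ≤ |∑ s, p.2 (a s) * p.2 (b s)|}) ?_ ?_
  · refine (measurable_fst (measurableSet_momentSet q K)).inter
      (measurableSet_le (g := fun p : β × (ι → ℝ) => |∑ s, p.2 (a s) * p.2 (b s)|)
        measurable_const ?_)
    fun_prop
  · filter_upwards [ae_iIndepFun_condLaw hX hU hind,
      ae_all_iff.2 fun i => ae_integral_condLaw_eq_zero hX hU i (hint i) (hmean i)] with ω h1 h2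
    by_cases hG : X ω ∈ momentSet μ X U q K
    · have := measureReal_le_abs_sum_mul_mul_le h1 (fun i => measurable_pi_apply i)
        (integrable_of_mem_momentSet hq hG) h2 hq (integrable_rpow_of_mem_momentSet hG)
        (integral_rpow_le_of_mem_momentSet hK hG) hab ht hy x
      refine le_trans (measure_mono (t := {z : ι → ℝ | x ≤ |∑ s, z (a s) * z (b s)|})
        fun z hz => hz.2) ?_
      rw [← ofReal_measureReal]
      exact ENNReal.ofReal_le_ofReal this
    · rw [measure_mono_null (t := ∅) (fun z hz => hG hz.1) measure_empty]
      exact zero_le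

end Conditional

theorem tailBound_mono {q K K' N N' t y x : ℝ} (hK : 0 ≤ K) (hKK : K ≤ K') (hN : 0 ≤ N)
    (hNN : N ≤ N') (hy : 0 < y) : tailBound q K N t y x ≤ tailBound q K' N' t y x := by
  have := hK.trans hKK
  have := hN.trans hNN
  unfold tailBound
  gcongr

/-! ### Consequences of the rate condition -/

section Rate

variable {ν : ℝ} {p : ℕ → ℕ}

theorem eventually_rate_le (hp : ∀ n, 0 < p n)
    (hrate : (fun n : ℕ => (n : ℝ) ^ (4 / ν) * Real.log n ^ ((ν - 2) / ν) / (p n : ℝ))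
      =O[atTop] (fun _ => (1 : ℝ))) :
    ∃ D : ℝ, 0 < D ∧ ∀ᶠ n : ℕ in atTop, 1 ≤ Real.log n ∧
      (n : ℝ) ^ (4 / ν) * Real.log n ^ ((ν - 2) / ν) ≤ D * p n := by
  obtain ⟨D, hD, hbound⟩ := hrate.exists_pos
  refine ⟨D, hD, ?_⟩
  filter_upwards [hbound.bound, (Real.tendsto_log_atTop.comp
    tendsto_natCast_atTop_atTop).eventually_ge_atTop 1] with n h1 h2
  refine ⟨h2, ?_⟩
  have hpn : (0 : ℝ) < p n := by exact_mod_cast hp n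
  have := (le_abs_self _).trans h1
  rw [norm_one, mul_one, div_le_iff₀ hpn] at this
  exact this

theorem tendsto_sqrt_log_div (hν : 0 < ν) (hp : ∀ n, 0 < p n)
    (hrate : (fun n : ℕ => (n : ℝ) ^ (4 / ν) * Real.log n ^ ((ν - 2) / ν) / (p n : ℝ))
      =O[atTop] (fun _ => (1 : ℝ))) :
    Tendsto (fun n : ℕ => √(Real.log n / (p n : ℝ))) atTop (𝓝 0) := by
  obtain ⟨D, hD, hev⟩ := eventually_rate_le hp hrate
  rw [← Real.sqrt_zero]
  refine (Real.continuous_sqrt.tendsto 0).comp ?_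
  have hlim : Tendsto (fun n : ℕ => D * (Real.log n ^ (2 / ν) / (n : ℝ) ^ (4 / ν))) atTop (𝓝 0) := by
    have := ((isLittleO_log_rpow_rpow_atTop (2 / ν) (s := 4 / ν)
      (by positivity)).tendsto_div_nhds_zero.comp tendsto_natCast_atTop_atTop).const_mul D
    simpa using this
  refine tendsto_of_tendsto_of_tendsto_of_le_of_le' tendsto_const_nhds hlim ?_ ?_
  · filter_upwards [hev] with n h; have := h.1; positivity
  · filter_upwards [hev, eventually_ge_atTop 1] with n h hn
    have hL : 0 < Real.log n := by linarith [h.1]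
    have hpn : (0 : ℝ) < p n := by exact_mod_cast hp n
    have hnpos : (0 : ℝ) < n := by exact_mod_cast hn
    rw [← mul_div_assoc, div_le_div_iff₀ hpn (by positivity)]
    have e : Real.log n = Real.log n ^ (2 / ν) * Real.log n ^ ((ν - 2) / ν) := by
      rw [← Real.rpow_add hL, show 2 / ν + (ν - 2) / ν = 1 by field_simp; ring, Real.rpow_one]
    calc Real.log n * (n : ℝ) ^ (4 / ν) =
          Real.log n ^ (2 / ν) * ((n : ℝ) ^ (4 / ν) * Real.log n ^ ((ν - 2) / ν)) := by
          conv_lhs => rw [e]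
          ring
      _ ≤ Real.log n ^ (2 / ν) * (D * p n) := mul_le_mul_of_nonneg_left h.2 (by positivity)
      _ = _ := by ring

/-- With `L = log n`, the expression equals `n ^ 2 * p ^ (-ν/2) * L ^ (-1 - ν/2)`. The rate
condition raised to the power `ν / 2` bounds `n ^ 2 * L ^ (ν/2 - 1)` by a multiple of `p ^ (ν/2)`,
and a factor `L ^ (-ν)` is left over. -/
theorem tendsto_sq_mul_mul_rpow (hν : 0 < ν) (hp : ∀ n, 0 < p n)
    (hrate : (fun n : ℕ => (n : ℝ) ^ (4 / ν) * Real.log n ^ ((ν - 2) / ν) / (p n : ℝ))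
      =O[atTop] (fun _ => (1 : ℝ))) :
    Tendsto (fun n : ℕ => (n : ℝ) ^ 2 * (p n * (p n * √(Real.log n / p n)) ^ (-(2 + ν)))) atTop
      (𝓝 0) := by
  obtain ⟨D, hD, hev⟩ := eventually_rate_le hp hrate
  have hlim : Tendsto (fun n : ℕ => D ^ (ν / 2) * Real.log n ^ (-ν)) atTop (𝓝 0) := by
    have := ((tendsto_rpow_neg_atTop hν).comp (Real.tendsto_log_atTop.comp
      tendsto_natCast_atTop_atTop)).const_mul (D ^ (ν / 2))
    simpa using this
  refine tendsto_of_tendsto_of_tendsto_of_le_of_le' tendsto_const_nhds hlim ?_ ?_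
  · filter_upwards with n; positivity
  · filter_upwards [hev, eventually_ge_atTop 1] with n h hn
    have hL : 0 < Real.log n := by linarith [h.1]
    have hpn : (0 : ℝ) < p n := by exact_mod_cast hp n
    have hnpos : (0 : ℝ) < n := by exact_mod_cast hn
    set L := Real.log n
    set P : ℝ := ((p n : ℕ) : ℝ)
    have h1 : P * √(L / P) = (P * L) ^ (1 / 2 : ℝ) := by
      rw [← Real.sqrt_eq_rpow, show P * L = P ^ 2 * (L / P) by field_simp,
        Real.sqrt_mul (sq_nonneg P), Real.sqrt_sq hpn.le]
    have h2 : P * (P * √(L / P)) ^ (-(2 + ν)) = P ^ (-(ν / 2)) * L ^ (-1 - ν / 2) := by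
      rw [h1, ← Real.rpow_mul (by positivity), Real.mul_rpow hpn.le hL.le, ← mul_assoc]
      conv_lhs => rw [show P * P ^ (1 / 2 * -(2 + ν)) = P ^ (1 : ℝ) * P ^ (1 / 2 * -(2 + ν)) by
        rw [Real.rpow_one]]
      rw [← Real.rpow_add hpn]
      congr 2 <;> ring
    have h3 : (n : ℝ) ^ 2 * L ^ (ν / 2 - 1) ≤ D ^ (ν / 2) * P ^ (ν / 2) := by
      rw [← Real.mul_rpow hD.le hpn.le]
      refine le_trans (le_of_eq ?_) (Real.rpow_le_rpow (by positivity) h.2 (by positivity))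
      rw [Real.mul_rpow (by positivity) (by positivity), ← Real.rpow_mul hnpos.le,
        ← Real.rpow_mul hL.le, ← Real.rpow_natCast]
      congr 2 <;> field_simp
      norm_num
    rw [h2]
    have h4 : P ^ (-(ν / 2)) * P ^ (ν / 2) = 1 := by rw [← Real.rpow_add hpn]; simp
    have h5 : L ^ (-1 - ν / 2) = L ^ (ν / 2 - 1) * L ^ (-ν) := by
      rw [← Real.rpow_add hL]; congr 1; ring
    calc (n : ℝ) ^ 2 * (P ^ (-(ν / 2)) * L ^ (-1 - ν / 2)) =
          P ^ (-(ν / 2)) * ((n : ℝ) ^ 2 * L ^ (ν / 2 - 1)) * L ^ (-ν) := by rw [h5]; ring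
      _ ≤ P ^ (-(ν / 2)) * (D ^ (ν / 2) * P ^ (ν / 2)) * L ^ (-ν) := by gcongr
      _ = D ^ (ν / 2) * (P ^ (-(ν / 2)) * P ^ (ν / 2)) * L ^ (-ν) := by ring
      _ = _ := by rw [h4, mul_one]

/-- With `t = a` and `y = p a`, both `t * y` and `p * t ^ 2` equal `log n`. The variance term costs
`exp (2 + ν) * (1 + K) * log n`; the additional `3` in `b` leaves `n⁻³`, enough against `n ^ 2`
pairs. -/
theorem tendsto_sq_mul_tailBound (hν : 0 < ν) (hp : ∀ n, 0 < p n)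
    (hrate : (fun n : ℕ => (n : ℝ) ^ (4 / ν) * Real.log n ^ ((ν - 2) / ν) / (p n : ℝ))
      =O[atTop] (fun _ => (1 : ℝ))) {K b : ℝ} (hK : 0 ≤ K)
    (hb : Real.exp (2 + ν) * (1 + K) + 3 ≤ b) :
    Tendsto (fun n : ℕ => (n : ℝ) ^ 2 * tailBound (2 + ν) K (p n) √(Real.log n / p n)
      (p n * √(Real.log n / p n)) (b * (p n * √(Real.log n / p n)))) atTop (𝓝 0) := by
  have hψ := tendsto_sq_mul_mul_rpow hν hp hrate
  obtain ⟨D, hD, hev⟩ := eventually_rate_le hp hrate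
  have hlim := (hψ.const_mul (2 * K)).add
    ((tendsto_inv_atTop_zero.comp tendsto_natCast_atTop_atTop).const_mul (2 * Real.exp K))
  rw [mul_zero, mul_zero, add_zero] at hlim
  refine tendsto_of_tendsto_of_tendsto_of_le_of_le' tendsto_const_nhds hlim ?_ ?_
  · filter_upwards with n; unfold tailBound; positivity
  · filter_upwards [hev, eventually_ge_atTop 1, hψ.eventually_le_const one_pos] with n h hn hψ1
    have hL : 0 < Real.log n := by linarith [h.1]
    have hpn : (0 : ℝ) < p n := by exact_mod_cast hp n
    have hn1 : (1 : ℝ) ≤ n := by exact_mod_cast hn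
    have hnpos : (0 : ℝ) < n := by linarith
    have hexpL : Real.exp (Real.log n) = n := Real.exp_log hnpos
    set L := Real.log n
    set P : ℝ := ((p n : ℕ) : ℝ)
    set a := √(L / P)
    have ha2 : a * a * P = L := by
      rw [Real.mul_self_sqrt (by positivity)]; field_simp
    set ψ := P * (P * a) ^ (-(2 + ν)) with hψdef
    have hψ0 : 0 ≤ ψ := by positivity
    -- Since `exp (t * y) = n`, the last term of the exponent is `n * ψ * K`, hence at most `K`.
    have hnψ : n * ψ ≤ 1 := by
      refine le_trans ?_ hψ1
      gcongr; nlinarith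
    have e1 : a * (P * a) = L := by linarith
    have hexp : Real.exp (-a * (b * (P * a)) + P * (Real.exp (2 + ν) * a ^ 2 * (1 + K) +
        (P * a) ^ (-(2 + ν)) * Real.exp (a * (P * a)) * K)) ≤ Real.exp K * (n : ℝ)⁻¹ ^ 3 := by
      have e2 : (n : ℝ)⁻¹ ^ 3 = Real.exp (-3 * L) := by
        rw [← hexpL, ← Real.exp_neg, ← Real.exp_nat_mul]; congr 1; push_cast; ring
      rw [e2, ← Real.exp_add, e1, hexpL]
      refine Real.exp_le_exp.2 ?_
      have e3 : -a * (b * (P * a)) + P * (Real.exp (2 + ν) * a ^ 2 * (1 + K) +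
          (P * a) ^ (-(2 + ν)) * n * K) =
          -b * (a * a * P) + Real.exp (2 + ν) * (1 + K) * (a * a * P) + (n * ψ) * K := by
        rw [hψdef]; ring
      rw [e3, ha2]
      nlinarith
    have hcube : (n : ℝ) ^ 2 * (n : ℝ)⁻¹ ^ 3 = (n : ℝ)⁻¹ := by field_simp
    calc (n : ℝ) ^ 2 * tailBound (2 + ν) K P a (P * a) (b * (P * a)) ≤
          (n : ℝ) ^ 2 * (2 * (ψ * K + Real.exp K * (n : ℝ)⁻¹ ^ 3)) := by
          unfold tailBound
          rw [show P * (K * (P * a) ^ (-(2 + ν))) = ψ * K by rw [hψdef]; ring]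
          gcongr
      _ = 2 * K * ((n : ℝ) ^ 2 * ψ) + 2 * Real.exp K * ((n : ℝ) ^ 2 * (n : ℝ)⁻¹ ^ 3) := by ring
      _ = _ := by rw [hcube]; rfl

end Rate

/-! ### Measurable evaluation and perturbation of the distance -/

/-- Evaluation need not be measurable for the product σ-field on all functions. Evaluating at simple
approximations with values in `A` is measurable, and the limit is correct for functions continuous
on `A`. This makes `η_l(α_i)` a measurable function of the latent element. -/
theorem exists_measurable_eval {E : Type*} [PseudoEMetricSpace E] [MeasurableSpace E] [BorelSpace E]
    [SecondCountableTopology E] {A : Set E} (hne : A.Nonempty) :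
    ∃ e : E × (E → ℝ) → ℝ, Measurable e ∧
      ∀ x ∈ A, ∀ f : E → ℝ, ContinuousOn f A → e (x, f) = f x := by
  obtain ⟨y₀, h₀⟩ := hne
  set φ : ℕ → SimpleFunc (E × (E → ℝ)) E :=
    fun k => SimpleFunc.approxOn Prod.fst measurable_fst A y₀ h₀ k
  have hφ : ∀ k, Measurable fun b : E × (E → ℝ) => b.2 (φ k b) := fun k =>
    (φ k).measurable_bind (fun v b => b.2 v)
      fun v => (measurable_pi_apply v).comp measurable_snd
  refine ⟨fun b => limUnder atTop fun k => b.2 (φ k b), ?_, fun x hx f hf => ?_⟩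
  · exact (StronglyMeasurable.limUnder fun k => (hφ k).stronglyMeasurable).measurable
  · refine Tendsto.limUnder_eq ?_
    have h1 : Tendsto (fun k => φ k (x, f)) atTop (𝓝[A] x) :=
      tendsto_nhdsWithin_iff.2 ⟨SimpleFunc.tendsto_approxOn measurable_fst h₀ (subset_closure hx),
        Eventually.of_forall fun k => SimpleFunc.approxOn_mem measurable_fst h₀ k _⟩
    exact (hf x hx).tendsto.comp h1

theorem abs_pseudoMaxDist_sub_le {n : ℕ} {ι : Type} [Fintype ι] {v w : Fin n → EuclideanSpace ℝ ι}
    {i j : Fin n} {B : ℝ} (hB : 0 ≤ B) (h : ∀ l, l ≠ i → l ≠ j →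
      |inner ℝ (v i - v j) (v l) - inner ℝ (w i - w j) (w l)| / (Fintype.card ι : ℝ) ≤ B) :
    |pseudoMaxDist n ι v i j - pseudoMaxDist n ι w i j| ≤ B := by
  unfold pseudoMaxDist
  -- If no index other than `i`, `j` exists, both suprema are over an empty type and equal `0`.
  cases isEmpty_or_nonempty {l : Fin n // l ≠ i ∧ l ≠ j}
  · simpa [Real.iSup_of_isEmpty] using hB
  have key : ∀ (l : {l : Fin n // l ≠ i ∧ l ≠ j}),
      |(|inner ℝ (v i - v j) (v l)| / (Fintype.card ι : ℝ) -
        |inner ℝ (w i - w j) (w l)| / (Fintype.card ι : ℝ))| ≤ B := by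
    intro l
    rw [← sub_div, abs_div, Nat.abs_cast]
    exact (div_le_div_of_nonneg_right (abs_abs_sub_abs_le_abs_sub _ _) (by positivity)).trans
      (h l l.2.1 l.2.2)
  rw [abs_sub_le_iff, sub_le_iff_le_add, sub_le_iff_le_add]
  constructor
  · refine ciSup_le fun l => ?_
    have h1 := (abs_sub_le_iff.1 (key l)).1
    have h2 := le_ciSup (f := fun l : {l : Fin n // l ≠ i ∧ l ≠ j} =>
      |inner ℝ (w i - w j) (w l)| / (Fintype.card ι : ℝ)) (Set.finite_range _).bddAbove l
    linarith
  · refine ciSup_le fun l => ?_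
    have h1 := (abs_sub_le_iff.1 (key l)).2
    have h2 := le_ciSup (f := fun l : {l : Fin n // l ≠ i ∧ l ≠ j} =>
      |inner ℝ (v i - v j) (v l)| / (Fintype.card ι : ℝ)) (Set.finite_range _).bddAbove l
    linarith

/-- The exclusion `l ≠ i, j` is what keeps the noncentred terms `‖U l‖ ^ 2` out of the six-term
expansion. -/
theorem abs_inner_add_sub_inner_le {V : Type*} [NormedAddCommGroup V] [InnerProductSpace ℝ V]
    {n : ℕ} {H U : Fin n → V} {x : ℝ} (hlin : ∀ i l, |inner ℝ (U i) (H l)| ≤ x)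
    (hquad : ∀ i l, i ≠ l → |inner ℝ (U i) (U l)| ≤ x) {i j l : Fin n} (hi : l ≠ i) (hj : l ≠ j) :
    |inner ℝ ((H i + U i) - (H j + U j)) (H l + U l) - inner ℝ (H i - H j) (H l)| ≤ 6 * x := by
  have e : inner ℝ ((H i + U i) - (H j + U j)) (H l + U l) - inner ℝ (H i - H j) (H l) =
      inner ℝ (U i) (H l) - inner ℝ (U j) (H l) + inner ℝ (U l) (H i) - inner ℝ (U l) (H j) +
        inner ℝ (U i) (U l) - inner ℝ (U j) (U l) := by
    simp only [inner_sub_left, inner_add_left, inner_add_right]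
    rw [real_inner_comm (H i) (U l), real_inner_comm (H j) (U l)]
    ring
  have h1 := abs_le.1 (hlin i l)
  have h2 := abs_le.1 (hlin j l)
  have h3 := abs_le.1 (hlin l i)
  have h4 := abs_le.1 (hlin l j)
  have h5 := abs_le.1 (hquad i l hi.symm)
  have h6 := abs_le.1 (hquad j l hj.symm)
  rw [e, abs_le]
  constructor <;> linarith

/-! ### The denoising bound -/

section StochLE

variable {Ω : Type*} [MeasurableSpace Ω] {μ : Measure Ω}

theorem StochLE.of_forall_eventually_le {X Y : ℕ → Ω → ℝ}
    (h : ∀ δ : ℝ≥0∞, 0 < δ → ∀ᶠ ε : ℝ in atTop, ∀ᶠ n in atTop,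
      μ {ω | ε * |Y n ω| ≤ |X n ω|} ≤ δ) : StochLE μ X Y := by
  refine nonpos_iff_eq_zero.1 (le_of_forall_pos_le_add fun δ hδ => ?_)
  rw [zero_add]
  refine limsup_le_of_le (by isBoundedDefault) ?_
  filter_upwards [h δ hδ] with ε hε
  exact limsup_le_of_le (by isBoundedDefault) hε

end StochLE

namespace FactorModel

variable {Ω : Type*} [mΩ : MeasurableSpace Ω] {r : ℕ} (M : FactorModel Ω r)
  {μ : Measure Ω} {A : Set (EuclideanSpace ℝ (Fin r))} {m : ℕ} {ν : ℝ}

/-- The latent variables and the latent functions, as one random element. -/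
def latent (n : ℕ) (ω : Ω) :
    (Fin n → EuclideanSpace ℝ (Fin r)) × (Fin (M.p n) → EuclideanSpace ℝ (Fin r) → ℝ) :=
  (fun i => M.α n i ω, fun l x => M.η n l ω x)

theorem measurable_latent (n : ℕ) : Measurable (M.latent n) :=
  (measurable_pi_lambda _ fun i => M.measurable_α n i).prodMk
    (measurable_pi_lambda _ fun l => measurable_pi_lambda _ fun x => M.measurable_η n l x)

/-- Presents `F n` as generated by a single random element, so that conditioning on it is given by a
kernel. -/
theorem comap_latent (n : ℕ) : MeasurableSpace.comap (M.latent n) inferInstance = M.F n := by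
  unfold latent F
  change MeasurableSpace.comap (fun ω => ((fun i => M.α n i ω), fun l x => M.η n l ω x))
    (MeasurableSpace.prod MeasurableSpace.pi MeasurableSpace.pi) = _
  rw [MeasurableSpace.comap_prodMk]
  simp only [MeasurableSpace.pi, MeasurableSpace.comap_iSup, MeasurableSpace.comap_comp]
  rfl

/-- The `i`-th column of errors, rows in `R n`. -/
def errors (n : ℕ) (ω : Ω) (i : Fin n) : EuclideanSpace ℝ (M.R n) :=
  WithLp.toLp 2 fun l => M.u n i l ω

variable {M}

namespace Regularity

theorem ae_mem (hreg : M.Regularity μ A m ν) (n : ℕ) : ∀ᵐ ω ∂μ, ∀ i, M.α n i ω ∈ A := by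
  rw [ae_all_iff]
  intro i
  obtain ⟨c, C, hc, hf⟩ := hreg.density
  obtain ⟨f, hfm, hfb, hmap⟩ := hf n
  have hA : MeasurableSet A := hreg.isCompact.isClosed.measurableSet
  have h1 : ∀ᵐ x ∂(μ.map (M.α n i)), x ∈ A := by
    rw [hmap i]
    exact (withDensity_absolutelyContinuous _ _).ae_le (ae_restrict_mem hA)
  exact ae_of_ae_map (M.measurable_α n i).aemeasurable h1

/-- A convex set has null frontier. With empty interior `A` would be null, and the law of a latent
variable, having a density on `A`, would vanish. -/
theorem interior_nonempty [IsProbabilityMeasure μ] (hreg : M.Regularity μ A m ν) : (interior A).Nonempty := by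
  by_contra h
  rw [Set.not_nonempty_iff_eq_empty] at h
  obtain ⟨c, C, hc, hf⟩ := hreg.density
  obtain ⟨f, hfm, hfb, hmap⟩ := hf 1
  have h1 : volume A = 0 := by
    refine measure_mono_null (fun x hx => ?_) (hreg.convex.addHaar_frontier volume)
    exact ⟨subset_closure hx, by simp [h]⟩
  have h2 := hmap 0
  rw [Measure.restrict_eq_zero.2 h1, withDensity_zero_left] at h2
  have : IsProbabilityMeasure (μ.map (M.α 1 0)) :=
    Measure.isProbabilityMeasure_map (M.measurable_α 1 0).aemeasurable
  exact IsProbabilityMeasure.ne_zero _ h2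

theorem uniqueDiffOn [IsProbabilityMeasure μ] (hreg : M.Regularity μ A m ν) : UniqueDiffOn ℝ A :=
  uniqueDiffOn_convex hreg.convex hreg.interior_nonempty

theorem exists_smoothFamily (hreg : M.Regularity μ A m ν) :
    ∃ C : ℝ, 0 ≤ C ∧ ∀ n, ∀ᵐ ω ∂μ, SmoothFamily A m C fun l => M.η n l ω := by
  obtain ⟨C, hC⟩ := hreg.smooth
  refine ⟨max C 0, le_max_right _ _, fun n => ?_⟩
  filter_upwards [hC n] with ω hω l
  exact ⟨(hω l).1, fun k hk x hx => ((hω l).2 k hk x hx).trans (le_max_left _ _)⟩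

/-- The supremum of the conditional moments is a finite random variable, hence tight; it already
runs over all sample sizes, so `K` does not depend on `n`. -/
theorem exists_measure_notMem_momentSet_le [IsProbabilityMeasure μ] (hreg : M.Regularity μ A m ν) {δ : ℝ≥0∞} (hδ : 0 < δ) :
    ∃ K : ℝ, 0 ≤ K ∧ ∀ n, μ {ω | M.latent n ω ∉
      momentSet μ (M.latent n) (fun q : Fin n × Fin (M.p n) => M.u n q.1 q.2) (2 + ν) K} ≤ δ := by
  set S : Ω → ℝ≥0∞ := fun ω => ⨆ n, ⨆ i, ⨆ l,
    condLExp (M.F n) μ (fun ω' => ENNReal.ofReal (|M.u n i l ω'| ^ (2 + ν))) ω with hS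
  have hSm : Measurable S := Measurable.iSup fun n => Measurable.iSup fun i => Measurable.iSup
    fun l => (measurable_condLExp (M.F n) μ _).mono (M.F_le n) le_rfl
  have hlim : Tendsto (fun k : ℕ => μ {ω | (k : ℝ≥0∞) < S ω}) atTop (𝓝 0) := by
    have h0 : μ (⋂ k : ℕ, {ω | (k : ℝ≥0∞) < S ω}) = 0 := by
      have h1 : μ {ω | ¬ S ω < ∞} = 0 := hreg.moment
      refine measure_mono_null (t := {ω | ¬ S ω < ∞}) (fun ω hω (h : S ω < ∞) => ?_) h1
      obtain ⟨k, hk⟩ := ENNReal.exists_nat_gt h.ne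
      have hk' : (k : ℝ≥0∞) < S ω := Set.mem_iInter.1 hω k
      exact absurd hk' (not_lt.2 hk.le)
    rw [← h0]
    refine tendsto_measure_iInter_atTop
      (fun k => (measurableSet_lt measurable_const hSm).nullMeasurableSet)
      (fun a b hab ω (hω : (b : ℝ≥0∞) < S ω) => (lt_of_le_of_lt ?_ hω : (a : ℝ≥0∞) < S ω)) ⟨0, measure_ne_top _ _⟩
    exact_mod_cast hab
  obtain ⟨k, hk⟩ := (hlim.eventually_le_const hδ).exists
  refine ⟨k, Nat.cast_nonneg k, fun n => ?_⟩
  have h1 : ∀ q : Fin n × Fin (M.p n), _ := fun q =>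
    ae_condLExp_eq_lintegral_condLaw (μ := μ) (M.measurable_latent n)
      (U := fun q : Fin n × Fin (M.p n) => M.u n q.1 q.2) (fun q => M.measurable_u n q.1 q.2) q
      (f := fun x => ENNReal.ofReal (|x| ^ (2 + ν))) (by fun_prop)
  refine (measure_mono_ae ?_).trans hk
  filter_upwards [ae_all_iff.2 h1] with ω hω hmem
  simp only [momentSet, Set.mem_ofPred_eq, not_forall, not_le] at hmem
  obtain ⟨q, hq⟩ := hmem
  rw [hω q, comap_latent, ENNReal.ofReal_natCast] at hq
  exact hq.trans_le (le_iSup_of_le n (le_iSup_of_le q.1 (le_iSup_of_le q.2 le_rfl)))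

theorem measure_denoising_le [IsProbabilityMeasure μ] (hreg : M.Regularity μ A m ν) {C : ℝ}
    (hsm : ∀ n, ∀ᵐ ω ∂μ, SmoothFamily A m C fun l => M.η n l ω) {K K' : ℝ} (hK : 0 ≤ K)
    (hC : 0 ≤ C) (hKC : K * C ^ (2 + ν) ≤ K') (hKK : K * K ≤ K') (n : ℕ) (hn : 0 < n) {t y x B : ℝ}
    (ht : 0 < t) (hy : 0 < y) (hx : 0 ≤ x) (hpR : 0 < M.pR n) (hxB : 6 * x < B * M.pR n) :
    μ {ω | B ≤ |(⨆ q : Fin n × Fin n, |pseudoMaxDist n (M.R n) (M.X n ω) q.1 q.2 -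
      pseudoMaxDist n (M.R n) (M.H n ω) q.1 q.2 - 0|)|} ≤
      μ {ω | M.latent n ω ∉ momentSet μ (M.latent n)
        (fun q : Fin n × Fin (M.p n) => M.u n q.1 q.2) (2 + ν) K} +
      ENNReal.ofReal (2 * ((n : ℝ) ^ 2 * tailBound (2 + ν) K' (M.p n) t y x)) := by
  have hν := hreg.ν_pos
  have hne : A.Nonempty := hreg.interior_nonempty.mono interior_subset
  obtain ⟨e, he, heval⟩ := exists_measurable_eval hne
  set U : Fin n × Fin (M.p n) → Ω → ℝ := fun q => M.u n q.1 q.2 with hUdef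
  set G := momentSet μ (M.latent n) U (2 + ν) K with hG
  have hU : ∀ q, Measurable (U q) := fun q => M.measurable_u n q.1 q.2
  set h : Fin n → M.R n → (Fin n → EuclideanSpace ℝ (Fin r)) ×
    (Fin (M.p n) → EuclideanSpace ℝ (Fin r) → ℝ) → ℝ := fun l s b => e (b.1 l, b.2 s) with hh
  have hhm : ∀ l s, Measurable (h l s) := fun l s => he.comp
    (((measurable_pi_apply l).comp measurable_fst).prodMk
      ((measurable_pi_apply (s : Fin (M.p n))).comp measurable_snd))
  have hind : CondIndepFamily μ (MeasurableSpace.comap (M.latent n) inferInstance) U := by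
    rw [comap_latent]; exact hreg.condIndep n
  have hmean : ∀ q, μ[U q | MeasurableSpace.comap (M.latent n) inferInstance] =ᵐ[μ] 0 := by
    intro q; rw [comap_latent]; exact hreg.condMean n q.1 q.2
  have hint : ∀ q, Integrable (U q) μ := fun q => hreg.integrable_u n q.1 q.2
  have hcard : (Fintype.card (M.R n) : ℝ) ≤ M.p n := by
    rw [Fintype.card_coe]
    exact_mod_cast (Finset.card_le_univ _).trans_eq (Fintype.card_fin _)
  set L : Fin n × Fin n → Set Ω := fun q => {ω | M.latent n ω ∈ G ∧
    (∀ s, |h q.2 s (M.latent n ω)| ≤ C) ∧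
    x ≤ |∑ s : M.R n, U (q.1, s) ω * h q.2 s (M.latent n ω)|} with hL
  set Q : Fin n × Fin n → Set Ω := fun q => {ω | q.1 ≠ q.2 ∧ M.latent n ω ∈ G ∧
    x ≤ |∑ s : M.R n, U (q.1, s) ω * U (q.2, s) ω|} with hQ
  set T := tailBound (2 + ν) K' (M.p n) t y x with hT
  have hT0 : 0 ≤ T := by
    have : 0 ≤ K' := (mul_nonneg hK hK).trans hKK
    rw [hT]; unfold tailBound; positivity
  have hLle : ∀ q, μ (L q) ≤ ENNReal.ofReal T := by
    intro q
    refine (measure_abs_sum_mul_le (M.measurable_latent n) hU hind hint hmean (by linarith) hK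
      (a := fun s : M.R n => (q.1, (s : Fin (M.p n)))) (fun s s' hs => Subtype.ext (by simpa using hs))
      (hhm q.2) ht hy x).trans ?_
    exact ENNReal.ofReal_le_ofReal
      (tailBound_mono (by positivity) hKC (by positivity) hcard hy)
  have hQle : ∀ q, μ (Q q) ≤ ENNReal.ofReal T := by
    intro q
    by_cases hq : q.1 = q.2
    · simp [hQ, hq]
    refine (measure_mono fun ω hω => hω.2).trans
      ((measure_abs_sum_mul_mul_le (M.measurable_latent n) hU hind hint hmean (by linarith) hK
      (a := fun s : M.R n => (q.1, (s : Fin (M.p n)))) (b := fun s : M.R n => (q.2, (s : Fin (M.p n))))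
      ?_ ht hy x).trans ?_)
    · rintro (s | s) (s' | s') hs <;> simp only [Sum.elim_inl, Sum.elim_inr, Prod.mk.injEq] at hs
      · rw [Subtype.ext hs.2]
      · exact absurd hs.1 hq
      · exact absurd hs.1.symm hq
      · rw [Subtype.ext hs.2]
    · exact ENNReal.ofReal_le_ofReal
        (tailBound_mono (by positivity) hKK (by positivity) hcard hy)
  -- Off the exceptional events every linear and off-diagonal quadratic inner product is below `x`,
  -- so the distances differ by at most `6 * x / M.pR n`, strictly less than `B`.
  have hsub : {ω | B ≤ |(⨆ q : Fin n × Fin n, |pseudoMaxDist n (M.R n) (M.X n ω) q.1 q.2 -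
      pseudoMaxDist n (M.R n) (M.H n ω) q.1 q.2 - 0|)|} ≤ᵐ[μ]
      ({ω | M.latent n ω ∉ G} ∪ ((⋃ q, L q) ∪ ⋃ q, Q q) : Set Ω) := by
    filter_upwards [hreg.ae_mem n, hsm n] with ω hmem hsmω hω
    by_contra hcon
    change ω ∉ ({ω | M.latent n ω ∉ G} ∪ ((⋃ q, L q) ∪ ⋃ q, Q q) : Set Ω) at hcon
    simp only [Set.mem_union, Set.mem_iUnion, not_or, not_exists, Set.mem_ofPred_eq, not_not] at hcon
    obtain ⟨h1, h2, h3⟩ := hcon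
    have hval : ∀ l (s : M.R n), h l s (M.latent n ω) = M.H n ω l s := fun l s =>
      heval _ (hmem l) _ (hsmω s).1.continuousOn
    have hbd : ∀ l (s : M.R n), |h l s (M.latent n ω)| ≤ C := fun l s => by
      rw [hval]; exact hsmω.abs_le s (hmem l)
    have hlin : ∀ i l, |inner ℝ (M.errors n ω i) (M.H n ω l)| ≤ x := by
      intro i l
      have := lt_of_not_ge fun hc => h2 (i, l) ⟨h1, hbd l, hc⟩
      refine le_trans (le_of_eq ?_) this.le
      simp only [hval, PiLp.inner_apply, RCLike.inner_apply, conj_trivial]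
      congr 1
      exact Finset.sum_congr rfl fun s _ => mul_comm _ _
    have hquad : ∀ i l, i ≠ l → |inner ℝ (M.errors n ω i) (M.errors n ω l)| ≤ x := by
      intro i l hil
      have := lt_of_not_ge fun hc => h3 (i, l) ⟨hil, h1, hc⟩
      refine le_trans (le_of_eq ?_) this.le
      simp only [PiLp.inner_apply, RCLike.inner_apply, conj_trivial]
      congr 1
      exact Finset.sum_congr rfl fun s _ => mul_comm _ _
    have hpRcard : (Fintype.card (M.R n) : ℝ) = M.pR n := by rw [Fintype.card_coe]; rfl
    have hsup : ⨆ q : Fin n × Fin n, |pseudoMaxDist n (M.R n) (M.X n ω) q.1 q.2 -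
        pseudoMaxDist n (M.R n) (M.H n ω) q.1 q.2 - 0| ≤ 6 * x / M.pR n := by
      have : Nonempty (Fin n × Fin n) := ⟨(⟨0, hn⟩, ⟨0, hn⟩)⟩
      refine ciSup_le fun q => ?_
      rw [sub_zero]
      refine abs_pseudoMaxDist_sub_le (by positivity) fun l hi hj => ?_
      rw [hpRcard]
      refine div_le_div_of_nonneg_right ?_ hpR.le
      exact abs_inner_add_sub_inner_le hlin hquad hi hj
    have hnn : 0 ≤ ⨆ q : Fin n × Fin n, |pseudoMaxDist n (M.R n) (M.X n ω) q.1 q.2 -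
        pseudoMaxDist n (M.R n) (M.H n ω) q.1 q.2 - 0| := Real.iSup_nonneg fun q => abs_nonneg _
    have hω' : B ≤ |(⨆ q : Fin n × Fin n, |pseudoMaxDist n (M.R n) (M.X n ω) q.1 q.2 -
      pseudoMaxDist n (M.R n) (M.H n ω) q.1 q.2 - 0|)| := hω
    rw [abs_of_nonneg hnn] at hω'
    have : 6 * x / M.pR n < B := by rwa [div_lt_iff₀ hpR]
    linarith
  have hunion : ∀ W : Fin n × Fin n → Set Ω, (∀ q, μ (W q) ≤ ENNReal.ofReal T) →
      μ (⋃ q, W q) ≤ ENNReal.ofReal ((n : ℝ) ^ 2 * T) := by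
    intro W hW
    refine (measure_iUnion_fintype_le μ W).trans ((Finset.sum_le_sum fun q _ => hW q).trans ?_)
    rw [Finset.sum_const, Finset.card_univ, Fintype.card_prod, Fintype.card_fin, nsmul_eq_mul,
      ENNReal.ofReal_mul (by positivity), ← Nat.cast_pow, ENNReal.ofReal_natCast, sq]
  refine (measure_mono_ae hsub).trans ((measure_union_le _ _).trans (add_le_add le_rfl ?_))
  refine (measure_union_le _ _).trans ((add_le_add (hunion L hLle) (hunion Q hQle)).trans ?_)
  rw [← ENNReal.ofReal_add (by positivity) (by positivity), two_mul]

theorem stochLE_denoising [IsProbabilityMeasure μ] (hreg : M.Regularity μ A m ν)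
    (hsplit : (fun n => M.pR n) =Θ[atTop] (fun n => (M.p n : ℝ)))
    (hrate : (fun n : ℕ => (n : ℝ) ^ (4 / ν) * Real.log n ^ ((ν - 2) / ν) / (M.p n : ℝ))
      =O[atTop] (fun _ => (1 : ℝ))) :
    StochLE μ (fun n ω => ⨆ q : Fin n × Fin n,
      |pseudoMaxDist n (M.R n) (M.X n ω) q.1 q.2 -
        pseudoMaxDist n (M.R n) (M.H n ω) q.1 q.2 - 0|)
      (fun n _ => √(Real.log n / (M.p n : ℝ))) := by
  obtain ⟨C, hC, hsm⟩ := hreg.exists_smoothFamily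
  obtain ⟨c, hc, hcp⟩ := hsplit.2.exists_pos
  refine StochLE.of_forall_eventually_le fun δ hδ => ?_
  obtain ⟨K, hK, hKn⟩ := hreg.exists_measure_notMem_momentSet_le (ENNReal.half_pos hδ.ne')
  set K' := K * C ^ (2 + ν) + K * K with hK'
  have hK1 : K * C ^ (2 + ν) ≤ K' := le_add_of_nonneg_right (mul_nonneg hK hK)
  have hK2 : K * K ≤ K' := le_add_of_nonneg_left (by positivity)
  set b := Real.exp (2 + ν) * (1 + K') + 3 with hb
  have hK'0 : 0 ≤ K' := by positivity
  have hbpos : 0 < b := by positivity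
  -- The `6` counts cross terms, `b` is the deviation constant of the tail bound, and `c` comes from
  -- `p ≤ c * pR`.
  filter_upwards [eventually_gt_atTop (6 * b * c)] with ε hε
  have hεpos : 0 < ε := lt_of_le_of_lt (by positivity) hε
  have htail := (tendsto_sq_mul_tailBound hreg.ν_pos M.p_pos hrate hK'0 (le_refl b)).const_mul 2
  rw [mul_zero] at htail
  have htail' := ENNReal.tendsto_ofReal htail
  rw [ENNReal.ofReal_zero] at htail'
  filter_upwards [htail'.eventually_le_const (ENNReal.half_pos hδ.ne'), hcp.bound,
    eventually_ge_atTop 2] with n h1 h2 hn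
  have hpn : (0 : ℝ) < M.p n := by exact_mod_cast M.p_pos n
  have hL : 0 < Real.log n := Real.log_pos (by exact_mod_cast hn)
  set a := √(Real.log n / (M.p n : ℝ)) with ha
  have hapos : 0 < a := Real.sqrt_pos.2 (by positivity)
  have hpRnn : 0 ≤ M.pR n := Nat.cast_nonneg _
  rw [Real.norm_of_nonneg hpn.le, Real.norm_of_nonneg hpRnn] at h2
  have hpR : 0 < M.pR n := by
    by_contra hcon
    have : M.pR n = 0 := le_antisymm (not_lt.1 hcon) hpRnn
    rw [this] at h2
    linarith
  have := hreg.measure_denoising_le hsm hK hC hK1 hK2 n (by omega) (t := a) (y := M.p n * a)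
    (x := b * (M.p n * a)) (B := ε * |a|) hapos (by positivity) (by positivity) hpR (by
      rw [abs_of_pos hapos]
      calc 6 * (b * (M.p n * a)) ≤ 6 * (b * ((c * M.pR n) * a)) := by gcongr
        _ = (6 * b * c) * a * M.pR n := by ring
        _ < ε * a * M.pR n := by gcongr)
  refine this.trans ((add_le_add (hKn n) h1).trans ?_)
  rw [ENNReal.add_halves]

end Regularity

end FactorModel

/-! ### Comparison of the distance with the latent distance -/

theorem pseudoMaxDist_le {n : ℕ} {ι : Type} [Fintype ι] {v : Fin n → EuclideanSpace ℝ ι}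
    {i j : Fin n} {B : ℝ} (hB : 0 ≤ B)
    (h : ∀ l, |inner ℝ (v i - v j) (v l)| ≤ B * (Fintype.card ι : ℝ)) :
    pseudoMaxDist n ι v i j ≤ B :=
  Real.iSup_le (fun l => div_le_of_le_mul₀ (by positivity) hB (h l)) hB

theorem le_pseudoMaxDist {n : ℕ} {ι : Type} [Fintype ι] (v : Fin n → EuclideanSpace ℝ ι)
    {i j l : Fin n} (hi : l ≠ i) (hj : l ≠ j) :
    |inner ℝ (v i - v j) (v l)| / (Fintype.card ι : ℝ) ≤ pseudoMaxDist n ι v i j :=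
  le_ciSup (f := fun l : {l : Fin n // l ≠ i ∧ l ≠ j} =>
    |inner ℝ (v i - v j) (v l)| / (Fintype.card ι : ℝ)) (Set.finite_range _).bddAbove ⟨l, hi, hj⟩

theorem pseudoMaxDist_nonneg {n : ℕ} {ι : Type} [Fintype ι] (v : Fin n → EuclideanSpace ℝ ι)
    (i j : Fin n) : 0 ≤ pseudoMaxDist n ι v i j :=
  Real.iSup_nonneg fun l => by positivity

namespace FactorModel

variable {Ω : Type*} [mΩ : MeasurableSpace Ω] {r : ℕ} {M : FactorModel Ω r}
  {μ : Measure Ω} [IsProbabilityMeasure μ] {A : Set (EuclideanSpace ℝ (Fin r))} {m : ℕ} {ν : ℝ}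

namespace Regularity

/-- Cauchy–Schwarz bounds the ratio by `C ^ 2` almost surely for every `n`, so the event is null
once `ε > C ^ 2`. -/
theorem stochLE_upper (hreg : M.Regularity μ A m ν) :
    StochLE μ (fun n ω => ⨆ q : {q : Fin n × Fin n // M.α n q.1 ω ≠ M.α n q.2 ω},
      pseudoMaxDist n (M.R n) (M.H n ω) q.1.1 q.1.2 /
        ‖M.α n q.1.1 ω - M.α n q.1.2 ω‖ ^ (1 : ℝ)) (fun _ _ => 1) := by
  obtain ⟨C, hC, hsm⟩ := hreg.exists_smoothFamily
  refine StochLE.of_forall_eventually_le fun δ _ => ?_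
  filter_upwards [eventually_gt_atTop (C ^ 2)] with ε hε
  refine Eventually.of_forall fun n => le_trans (le_of_eq ?_) (zero_le (a := δ))
  refine measure_eq_zero_iff_ae_notMem.2 ?_
  filter_upwards [hreg.ae_mem n, hsm n] with ω hmem hs
  rw [not_le, abs_one, mul_one]
  refine lt_of_le_of_lt ?_ hε
  have hsR : SmoothFamily A m C fun l : M.R n => M.η n l ω := fun l => hs l
  rw [abs_of_nonneg (Real.iSup_nonneg fun q => div_nonneg (pseudoMaxDist_nonneg _ _ _)
    (by positivity))]
  refine Real.iSup_le (fun q => ?_) (by positivity)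
  rw [Real.rpow_one]
  refine div_le_of_le_mul₀ (norm_nonneg _) (by positivity)
    (pseudoMaxDist_le (by positivity) fun l => ?_)
  refine (abs_real_inner_le_norm _ _).trans ((mul_le_mul
    (hsR.norm_toLp_sub_le hC hreg.two_le hreg.convex hreg.uniqueDiffOn (hmem q.1.2) (hmem q.1.1))
    (hsR.norm_toLp_le hC (hmem l)) (norm_nonneg _) (by positivity)).trans_eq ?_)
  have := Real.mul_self_sqrt (Nat.cast_nonneg (α := ℝ) (Fintype.card (M.R n)))
  calc _ = C ^ 2 * ‖M.α n q.1.1 ω - M.α n q.1.2 ω‖ *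
        (√(Fintype.card (M.R n) : ℝ) * √(Fintype.card (M.R n) : ℝ)) := by ring
    _ = _ := by rw [this]

/-- A convex set with nonempty interior lies in the closure of its interior, so a ball about a point
of `A` meets `A` in positive volume. The uniform lower bound on the density makes `θ` independent of
`n`. -/
theorem exists_le_measure_preimage_ball (hreg : M.Regularity μ A m ν)
    {w : EuclideanSpace ℝ (Fin r)} (hw : w ∈ A) {κ : ℝ} (hκ : 0 < κ) :
    ∃ θ : ℝ, 0 < θ ∧ ∀ n i, θ ≤ μ.real (M.α n i ⁻¹' Metric.ball w κ) := by
  obtain ⟨c, C, hc, hf⟩ := hreg.density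
  have hA : MeasurableSet A := hreg.isCompact.isClosed.measurableSet
  have hvol : 0 < volume (Metric.ball w κ ∩ A) := by
    have hcl : w ∈ closure (interior A) := by
      rw [hreg.convex.closure_interior_eq_closure_of_nonempty_interior hreg.interior_nonempty]
      exact subset_closure hw
    have hne : (Metric.ball w κ ∩ interior A).Nonempty :=
      mem_closure_iff_nhds.1 hcl _ (Metric.ball_mem_nhds w hκ)
    exact ((Metric.isOpen_ball.inter isOpen_interior).measure_pos volume hne).trans_le
      (measure_mono (Set.inter_subset_inter_right _ interior_subset))
  have hfin : volume (Metric.ball w κ ∩ A) ≠ ∞ :=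
    ne_top_of_le_ne_top hreg.isCompact.measure_lt_top.ne (measure_mono Set.inter_subset_right)
  refine ⟨c * volume.real (Metric.ball w κ ∩ A), mul_pos hc (ENNReal.toReal_pos hvol.ne' hfin),
    fun n i => ?_⟩
  obtain ⟨f, hfm, hfb, hmap⟩ := hf n
  have h1 : ENNReal.ofReal c * volume (Metric.ball w κ ∩ A) ≤
      μ (M.α n i ⁻¹' Metric.ball w κ) := by
    rw [← Measure.map_apply (M.measurable_α n i) measurableSet_ball, hmap i,
      withDensity_apply _ measurableSet_ball, Measure.restrict_restrict measurableSet_ball,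
      ← setLIntegral_const]
    refine setLIntegral_mono' (measurableSet_ball.inter hA) fun x hx => ?_
    exact ENNReal.ofReal_le_ofReal (hfb x hx.2).1
  have h2 := ENNReal.toReal_mono (measure_ne_top _ _) h1
  rwa [ENNReal.toReal_mul, ENNReal.toReal_ofReal hc.le] at h2

theorem measureReal_forall_notMem_le (hreg : M.Regularity μ A m ν)
    {B : Set (EuclideanSpace ℝ (Fin r))} (hB : MeasurableSet B) {n : ℕ} {θ s : ℝ}
    (hθ : ∀ i, θ ≤ μ.real (M.α n i ⁻¹' B)) (hs : 1 - θ ≤ s) (hs0 : 0 ≤ s) (hs1 : s ≤ 1)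
    (i j : Fin n) :
    μ.real {ω | ∀ l, l ≠ i → l ≠ j → M.α n l ω ∉ B} ≤ s ^ (n - 2) := by
  set S : Finset (Fin n) := Finset.univ \ {i, j} with hS
  have hcard : n - 2 ≤ S.card := by
    have h1 := Finset.le_card_sdiff ({i, j} : Finset (Fin n)) Finset.univ
    have h2 : ({i, j} : Finset (Fin n)).card ≤ 2 := Finset.card_le_two
    rw [Finset.card_univ, Fintype.card_fin] at h1
    rw [hS]
    omega
  have hsub : {ω | ∀ l, l ≠ i → l ≠ j → M.α n l ω ∉ B} ⊆ ⋂ l ∈ S, M.α n l ⁻¹' Bᶜ := by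
    intro ω hω
    refine Set.mem_iInter₂.2 fun l hl => ?_
    have : l ≠ i ∧ l ≠ j := by simpa [hS] using hl
    exact hω l this.1 this.2
  refine (measureReal_mono hsub).trans ?_
  rw [measureReal_def, (hreg.indep n).measure_inter_preimage_eq_mul S fun l _ => hB.compl,
    ENNReal.toReal_prod]
  calc ∏ l ∈ S, (μ (M.α n l ⁻¹' Bᶜ)).toReal ≤ ∏ _l ∈ S, s := by
        refine Finset.prod_le_prod (fun l _ => ENNReal.toReal_nonneg) fun l _ => ?_
        have : μ.real (M.α n l ⁻¹' Bᶜ) = 1 - μ.real (M.α n l ⁻¹' B) := by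
          rw [Set.preimage_compl, probReal_compl_eq_one_sub (M.measurable_α n l hB)]
        have h2 := hθ l
        change μ.real (M.α n l ⁻¹' Bᶜ) ≤ s
        linarith
    _ = s ^ S.card := by rw [Finset.prod_const]
    _ ≤ _ := pow_le_pow_of_le_one hs0 hs1 hcard

/-- With probability tending to one, every point of the support is close to a latent variable
other than any two given ones. -/
theorem probTendsToOne_dense (hreg : M.Regularity μ A m ν) {κ : ℝ} (hκ : 0 < κ) :
    ProbTendsToOne μ fun n => {ω | ∀ z ∈ A, ∀ i j : Fin n, ∃ l, l ≠ i ∧ l ≠ j ∧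
      ‖M.α n l ω - z‖ ≤ κ} := by
  -- With radius `κ / 2`, a latent variable in the same ball as `z` is within `κ` of it; only
  -- finitely many balls have to be hit.
  obtain ⟨T, hTA, hTfin, hcov⟩ := hreg.isCompact.finite_cover_balls (half_pos hκ)
  have hone : ∀ w ∈ T, Tendsto (fun n => μ {ω | ∃ i j : Fin n, ∀ l, l ≠ i → l ≠ j →
      M.α n l ω ∉ Metric.ball w (κ / 2)}) atTop (𝓝 0) := by
    intro w hw
    obtain ⟨θ, hθ, hθn⟩ := hreg.exists_le_measure_preimage_ball (hTA hw) (half_pos hκ)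
    -- The floor `1 / 2` keeps `s` positive, so that `s ^ (n - 2)` can be written as `s ^ n * (s ^
    -- 2)⁻¹`.
    set s : ℝ := max (1 - θ) (1 / 2) with hs
    have hs0 : 0 < s := lt_of_lt_of_le (by norm_num) (le_max_right _ _)
    have hs1 : s < 1 := max_lt (by linarith) (by norm_num)
    have hlim : Tendsto (fun n : ℕ => ENNReal.ofReal ((n : ℝ) ^ 2 * s ^ n * (s ^ 2)⁻¹)) atTop
        (𝓝 0) := by
      have := (tendsto_pow_const_mul_const_pow_of_abs_lt_one 2
        (by rwa [abs_of_pos hs0] : |s| < 1)).mul_const (s ^ 2)⁻¹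
      rw [zero_mul] at this
      simpa using ENNReal.tendsto_ofReal this
    refine tendsto_of_tendsto_of_tendsto_of_le_of_le' tendsto_const_nhds hlim
      (Eventually.of_forall fun _ => zero_le) ?_
    filter_upwards [eventually_ge_atTop 2] with n hn
    rw [← ofReal_measureReal]
    refine ENNReal.ofReal_le_ofReal ?_
    have hsub : {ω | ∃ i j : Fin n, ∀ l, l ≠ i → l ≠ j → M.α n l ω ∉ Metric.ball w (κ / 2)} ⊆
        ⋃ q : Fin n × Fin n, {ω | ∀ l, l ≠ q.1 → l ≠ q.2 → M.α n l ω ∉ Metric.ball w (κ / 2)} := by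
      rintro ω ⟨i, j, h⟩
      exact Set.mem_iUnion.2 ⟨(i, j), h⟩
    refine (measureReal_mono hsub).trans ((measureReal_iUnion_fintype_le _).trans
      ((Finset.sum_le_sum fun q _ => hreg.measureReal_forall_notMem_le measurableSet_ball
        (hθn n) (le_max_left _ _) hs0.le hs1.le q.1 q.2).trans_eq ?_))
    rw [Finset.sum_const, Finset.card_univ, Fintype.card_prod, Fintype.card_fin, nsmul_eq_mul,
      mul_assoc, ← pow_sub₀ s hs0.ne' hn]
    push_cast; ring
  have hsum : Tendsto (fun n => ∑ w ∈ hTfin.toFinset, μ {ω | ∃ i j : Fin n, ∀ l, l ≠ i → l ≠ j →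
      M.α n l ω ∉ Metric.ball w (κ / 2)}) atTop (𝓝 0) := by
    have := tendsto_finsetSum hTfin.toFinset fun w hw => hone w (hTfin.mem_toFinset.1 hw)
    rwa [Finset.sum_const_zero] at this
  refine tendsto_of_tendsto_of_tendsto_of_le_of_le tendsto_const_nhds hsum (fun _ => zero_le)
    fun n => ?_
  refine (measure_mono fun ω hω => ?_).trans (measure_biUnion_finset_le _ _)
  by_contra hcon
  refine hω fun z hz i j => ?_
  obtain ⟨w, hw, hzw⟩ := Set.mem_iUnion₂.1 (hcov hz)
  by_contra! hfar
  refine hcon (Set.mem_iUnion₂.2 ⟨w, hTfin.mem_toFinset.2 hw, i, j, fun l hi hj hball => ?_⟩)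
  have h1 := hfar l hi hj
  have h2 := dist_triangle_right (M.α n l ω) z w
  rw [Metric.mem_ball] at hball hzw
  rw [dist_eq_norm] at h2
  linarith

theorem exists_ne_mem (hreg : M.Regularity μ A m ν) (hr : 0 < r) : ∃ x ∈ A, ∃ y ∈ A, x ≠ y := by
  obtain ⟨x, hx⟩ := hreg.interior_nonempty
  obtain ⟨ρ, hρ, hball⟩ := Metric.nhds_basis_closedBall.mem_iff.1 (mem_interior_iff_mem_nhds.1 hx)
  have : Nonempty (Fin r) := ⟨⟨0, hr⟩⟩
  obtain ⟨e, he⟩ := exists_norm_eq (EuclideanSpace ℝ (Fin r)) hρ.le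
  refine ⟨x, interior_subset hx, x + e, hball (by simp [he]), fun h => ?_⟩
  have : e = 0 := by simpa using h
  rw [this, norm_zero] at he
  exact hρ.ne he

/-- Pairs within `δ₀` are handled by the local geometry and the density of the sample in `A`, the
others by identification. -/
theorem stochLE_lower (hreg : M.Regularity μ A m ν) (hr : 0 < r)
    (hpR : ∀ᶠ n in atTop, 0 < M.pR n) (hident : M.Identified μ pseudoMaxDist)
    (hjac : M.JacobianNondegenerate μ A) :
    StochLE μ (fun _ _ => 1)
      (fun n ω => ⨅ q : {q : Fin n × Fin n // M.α n q.1 ω ≠ M.α n q.2 ω},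
        pseudoMaxDist n (M.R n) (M.H n ω) q.1.1 q.1.2 /
          ‖M.α n q.1.1 ω - M.α n q.1.2 ω‖ ^ (1 : ℝ)) := by
  obtain ⟨C, hC, hsm⟩ := hreg.exists_smoothFamily
  obtain ⟨c, hc, hjac⟩ := hjac
  obtain ⟨κ, hκ, δ₀, hδ₀, b, hb, hgeom⟩ := exists_forall_le_abs_inner hreg.isCompact hreg.convex
    hreg.interior_nonempty m hreg.two_le C hC hc
  obtain ⟨x₁, hx₁, x₂, hx₂, hx₁₂⟩ := hreg.exists_ne_mem hr
  obtain ⟨D, hD⟩ := Metric.isBounded_iff.1 hreg.isCompact.isBounded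
  have hD0 : 0 < D := (dist_pos.2 hx₁₂).trans_le (hD hx₁ hx₂)
  -- The bound `dist x₁ x₂ / 3` forces the latent variables found near `x₁` and `x₂` to differ. The
  -- infimum is then over a nonempty set and not the default value `0`.
  set κ' := min κ (dist x₁ x₂ / 3) with hκ'
  have hκ'0 : 0 < κ' := lt_min hκ (by have := dist_pos.2 hx₁₂; positivity)
  have hdense := hreg.probTendsToOne_dense hκ'0
  refine StochLE.of_forall_eventually_le fun δ hδ => ?_
  have hδ3 : 0 < δ / 3 := ENNReal.div_pos hδ.ne' (by norm_num)
  obtain ⟨Δ, hΔlim, hΔ⟩ := (((hident δ₀ hδ₀).eventually_lt_const hδ3).and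
    self_mem_nhdsWithin).exists
  have hΔ0 : (0 : ℝ) < Δ := hΔ
  -- `b` is the slope for close pairs; `Δ / D` is the least distance over the largest separation for
  -- distant pairs.
  set c' := min b (Δ / D) with hc'
  have hc'0 : 0 < c' := lt_min hb (by positivity)
  filter_upwards [eventually_gt_atTop (1 / c')] with ε hε
  filter_upwards [eventually_lt_of_limsup_lt hΔlim, hjac.eventually_le_const hδ3,
    hdense.eventually_le_const hδ3, hpR, eventually_gt_atTop 0] with n h1 h2 h3 hpRn hn
  have hsub : {ω | ε * |⨅ q : {q : Fin n × Fin n // M.α n q.1 ω ≠ M.α n q.2 ω},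
        pseudoMaxDist n (M.R n) (M.H n ω) q.1.1 q.1.2 /
          ‖M.α n q.1.1 ω - M.α n q.1.2 ω‖ ^ (1 : ℝ)| ≤ |(1 : ℝ)|} ≤ᵐ[μ]
      ({ω | ∃ i j : Fin n, pseudoMaxDist n (M.R n) (M.H n ω) i j < Δ ∧
        δ₀ < ‖M.α n i ω - M.α n j ω‖} ∪
      ({ω | ∀ i : Fin n, c ≤ sMin ((1 / M.pR n) •
      ((M.jacobian A n ω (M.α n i ω)).transpose * M.jacobian A n ω (M.α n i ω)))}ᶜ ∪
      {ω | ∀ z ∈ A, ∀ i j : Fin n, ∃ l, l ≠ i ∧ l ≠ j ∧ ‖M.α n l ω - z‖ ≤ κ'}ᶜ) : Set Ω) := by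
    filter_upwards [hreg.ae_mem n, hsm n] with ω hmem hs hω
    by_contra hcon
    have hcon' := fun h => hcon (Or.inl h)
    have hJ := not_not.1 fun h => hcon (Or.inr (Or.inl h))
    have hden := not_not.1 fun h => hcon (Or.inr (Or.inr h))
    replace hJ : ∀ i : Fin n, c ≤ sMin ((1 / M.pR n) •
      ((M.jacobian A n ω (M.α n i ω)).transpose * M.jacobian A n ω (M.α n i ω))) := hJ
    replace hden : ∀ z ∈ A, ∀ i j : Fin n, ∃ l, l ≠ i ∧ l ≠ j ∧ ‖M.α n l ω - z‖ ≤ κ' := hden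
    replace hω : ε * |⨅ q : {q : Fin n × Fin n // M.α n q.1 ω ≠ M.α n q.2 ω},
        pseudoMaxDist n (M.R n) (M.H n ω) q.1.1 q.1.2 /
          ‖M.α n q.1.1 ω - M.α n q.1.2 ω‖ ^ (1 : ℝ)| ≤ |(1 : ℝ)| := hω
    have hsR : SmoothFamily A m C fun l : M.R n => M.η n l ω := fun l => hs l
    have hcard : M.pR n = Fintype.card (M.R n) := by rw [Fintype.card_coe]; rfl
    have hne : Nonempty {q : Fin n × Fin n // M.α n q.1 ω ≠ M.α n q.2 ω} := by
      obtain ⟨l₁, -, -, h₁⟩ := hden x₁ hx₁ ⟨0, hn⟩ ⟨0, hn⟩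
      obtain ⟨l₂, -, -, h₂⟩ := hden x₂ hx₂ ⟨0, hn⟩ ⟨0, hn⟩
      refine ⟨⟨(l₁, l₂), fun heq => ?_⟩⟩
      have h₃ := dist_triangle_left x₁ x₂ (M.α n l₁ ω)
      have h₄ : M.α n l₁ ω = M.α n l₂ ω := heq
      rw [dist_eq_norm (M.α n l₁ ω) x₁, h₄, dist_eq_norm (M.α n l₂ ω) x₂] at h₃
      rw [h₄] at h₁
      have h₅ : κ' ≤ dist x₁ x₂ / 3 := min_le_right _ _
      have := dist_pos.2 hx₁₂
      linarith
    have hlow : c' ≤ ⨅ q : {q : Fin n × Fin n // M.α n q.1 ω ≠ M.α n q.2 ω},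
        pseudoMaxDist n (M.R n) (M.H n ω) q.1.1 q.1.2 /
          ‖M.α n q.1.1 ω - M.α n q.1.2 ω‖ ^ (1 : ℝ) := by
      refine le_ciInf fun ⟨⟨i, j⟩, hij⟩ => ?_
      have hpos : 0 < ‖M.α n i ω - M.α n j ω‖ := norm_pos_iff.2 (sub_ne_zero.2 hij)
      rw [Real.rpow_one, le_div_iff₀ hpos]
      rcases le_or_gt ‖M.α n i ω - M.α n j ω‖ δ₀ with hle | hgt
      -- The surface is linearised at `α_j`; the witness `z` is then replaced by a sampled point
      -- whose index is admissible in the maximum.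
      · obtain ⟨z, hz, hzz⟩ := hgeom (M.R n) (fun l => M.η n l ω) (M.pR n) hcard hpRn hsR
          (M.α n j ω) (hmem j) (M.α n i ω) (hmem i) hle (M.jacobian A n ω (M.α n j ω))
          (fun l k => rfl) (fun v => mul_norm_le_norm_toEuclideanLin hr hc.le (hJ j) v)
        obtain ⟨l, hli, hlj, hl⟩ := hden z hz i j
        have h5 := hzz (M.α n l ω) (hmem l) (hl.trans (min_le_left _ _))
        refine le_trans ?_ (le_pseudoMaxDist (M.H n ω) hli hlj)
        rw [← hcard, le_div_iff₀ hpRn]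
        refine le_trans ?_ h5
        calc c' * ‖M.α n i ω - M.α n j ω‖ * M.pR n ≤ b * ‖M.α n i ω - M.α n j ω‖ * M.pR n := by
              gcongr; exact min_le_left _ _
          _ = _ := by ring
      · have h5 : Δ ≤ pseudoMaxDist n (M.R n) (M.H n ω) i j :=
          not_lt.1 fun h => hcon' ⟨i, j, h, hgt⟩
        refine le_trans ?_ h5
        have h6 := hD (hmem i) (hmem j)
        rw [dist_eq_norm] at h6
        calc c' * ‖M.α n i ω - M.α n j ω‖ ≤ Δ / D * D := by
              gcongr; exact min_le_right _ _
          _ = Δ := by field_simp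
    rw [abs_of_nonneg (hc'0.le.trans hlow), abs_one] at hω
    rw [div_lt_iff₀ hc'0] at hε
    have hε0 : 0 < ε := by
      by_contra hneg
      nlinarith
    nlinarith
  refine (measure_mono_ae hsub).trans ((measure_union_le _ _).trans ((add_le_add h1.le
    ((measure_union_le _ _).trans (add_le_add h2 h3))).trans_eq ?_))
  rw [← add_assoc, ENNReal.add_thirds]

end Regularity

end FactorModel

end

theorem mainTheorem5 {Ω : Type*} [MeasurableSpace Ω] (μ : Measure Ω) [IsProbabilityMeasure μ]
    {r : ℕ} (hr : 0 < r) (M : FactorModel Ω r) (A : Set (EuclideanSpace ℝ (Fin r)))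
    (m : ℕ) (ν : ℝ)
    (hreg : M.Regularity μ A m ν)
    (hsplit : (fun n => M.pR n) =Θ[atTop] (fun n => (M.p n : ℝ)))
    (hident : M.Identified μ pseudoMaxDist)
    (hjac : M.JacobianNondegenerate μ A)
    (hnc : M.NonCollapsing μ A)
    (hrate : (fun n : ℕ => (n : ℝ) ^ (4 / ν) * Real.log n ^ ((ν - 2) / ν) / (M.p n : ℝ))
      =O[atTop] (fun _ => (1 : ℝ))) :
    M.IndirectMatching μ pseudoMaxDist (fun n => Real.sqrt (Real.log n / (M.p n : ℝ))) 0 1 1 where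
  shift_nonneg := le_rfl
  lower_pos := one_pos
  upper_pos := one_pos
  a_pos := by
    filter_upwards [eventually_ge_atTop 2] with n hn
    have : (0 : ℝ) < M.p n := by exact_mod_cast M.p_pos n
    have : 0 < Real.log n := Real.log_pos (by exact_mod_cast hn)
    positivity
  a_tendsto := tendsto_sqrt_log_div hreg.ν_pos M.p_pos hrate
  denoising := hreg.stochLE_denoising hsplit hrate
  upper := hreg.stochLE_upper
  lower := by
    refine hreg.stochLE_lower hr ?_ hident hjac
    filter_upwards [hsplit.2.eq_zero_imp] with n hn
    have hpn : (M.p n : ℝ) ≠ 0 := by exact_mod_cast (M.p_pos n).ne'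
    exact lt_of_le_of_ne (Nat.cast_nonneg _) fun h => hpn (hn h.symm)
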